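/- \textbf{Theorem (Joint Density).} Let $\mathcal E$ and $\mathcal S$ be finite sets, let $\alpha$ be a probability (row) vector on $\mathcal E$, let $T$ (on $\mathcal E$) and $Q_1,Q_2$ (on $\mathcal S$) be nonsingular subintensity matrices (nonnegative off-diagonal entries, nonpositive row sums; nonsingularity means that all states are transient), let $U$ be a nonnegative $\mathcal E\times\mathcal S$ matrix with $T\mathbf 1+U\mathbf 1=\mathbf 0$, and let $a_1,a_2>0$. Let $J_{1,2}$ be a right-continuous Markov jump process on $\mathcal E\cup\mathcal S$ with initial distribution $(\alpha,\mathbf 0)$ and intensity matrix $\begin{pmatrix}T&U\\ \mathbf 0&\mathbf 0\end{pmatrix}$; put $\tau_{1,2}=\inf\{t\ge 0: J_{1,2}(t)\notin\mathcal E\}$ and $K=J_{1,2}(\tau_{1,2})\in\mathcal S$. Let $J_1,J_2$ be processes on $\mathcal E\cup\mathcal S\cup\{\partial\}$, where $\partial$ is an absorbing final state, such that $J_1(t)=J_2(t)=J_{1,2}(t)$ for $t\le\tau_{1,2}$ and such that, for every $k$ with $\mathbb P(K=k)>0$, conditionally on $\{K=k\}$ the processes $J_{1,2}$, $(J_1(\tau_{1,2}+s))_{s\ge0}$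 and $(J_2(\tau_{1,2}+s))_{s\ge0}$ are independent and $(J_i(\tau_{1,2}+s))_{s\ge 0}$ is, for $i=1,2$, a right-continuous Markov jump process started in $k$ and governed by the subintensity matrix $\begin{pmatrix}T&U\\ \mathbf 0&Q_i\end{pmatrix}$ on $\mathcal E\cup\mathcal S$ (that is, by $Q_i$ on $\mathcal S$), the missing rates leading to $\partial$. Let $\tilde\tau_i=\inf\{s\ge 0: J_i(\tau_{1,2}+s)\notin\mathcal S\}$ be the time that $J_i$ spends in $\mathcal S$ after the shock, and let $X_i=a_i\tau_{1,2}+\tilde\tau_i$, so that $(X_1,X_2)$ has the bivariate common-shock phase-type (CSPH) distribution with parameters $(\alpha,T,U,Q_1,Q_2,a_1,a_2)$. Write $q_i=-Q_i\mathbf 1$ and $$P=\sum_{k\in\mathcal S}u^{(k)}(e_k^\top\otimes e_k^\top),\qquad u^{(k)}=Ue_k,$$ where $e_k$ is the $k$-th unit vector, $\otimes$ is the Kronecker product and $A\oplus B=A\otimes I+I\otimes B$ is the Kronecker sum. For square matrices $A,C$, a matrix $B$ of matching size and $u\ge 0$ put $$V[A,B,C,u]=\begin{pmatrix}I&\mathbf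 0\end{pmatrix}\exp\left(\begin{pmatrix}A&B\\ \mathbf 0&C\end{pmatrix}u\right)\begin{pmatrix}\mathbf 0\\ I\end{pmatrix},$$ and let $z_1\curlywedge z_2=\min(z_1/a_1,z_2/a_2)$. Then: (1) the vector $(\tau_{1,2},\tilde\tau_1,\tilde\tau_2)$ has a probability density with respect to Lebesgue measure on $\mathbb R^3$, which vanishes outside $[0,\infty)^3$ and is given for $t,y_1,y_2\ge 0$ by $$g(t,y_1,y_2)=\alpha e^{Tt}P\big((e^{Q_1y_1}q_1)\otimes(e^{Q_2y_2}q_2)\big);$$ (2) the vector $(X_1,X_2)$ has a probability density with respect to Lebesgue measure on $\mathbb R^2$, which vanishes outside $[0,\infty)^2$ and is given for $z_1,z_2\ge 0$ by $$f_{X_1,X_2}(z_1,z_2)=\alpha\,V\big[T,P,(a_1Q_1)\oplus(a_2Q_2),z_1\curlywedge z_2\big]\big(q_1(z_1,z_2)\otimes q_2(z_1,z_2)\big),$$ where $q_i(z_1,z_2)=e^{Q_i(z_i-a_i(z_1\curlywedge z_2))}q_i$ for $i=1,2$. -/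

import Mathlib

open MeasureTheory ProbabilityTheory Topology
open scoped NNReal ENNReal Matrix Kronecker

namespace CSPH

noncomputable section

/-! ### Matrix notions -/

/-- A subintensity matrix: nonnegative off-diagonal entries and nonpositive row sums (so that the
diagonal entries are nonpositive). -/
structure IsSubintensity {E : Type*} [Fintype E] (Q : Matrix E E ℝ) : Prop where
  offDiag_nonneg : ∀ i j, i ≠ j → 0 ≤ Q i j
  rowSum_nonpos : ∀ i, (Q *ᵥ 1) i ≤ 0

/-- Completion of a subintensity matrix by an absorbing cemetery state `none`: the missing rate
`-(Q 1) i` leads from `i` to the cemetery. -/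
def withCemetery {E : Type*} [Fintype E] (Q : Matrix E E ℝ) : Matrix (Option E) (Option E) ℝ
  | some i, some j => Q i j
  | some i, none => -(Q *ᵥ 1) i
  | none, _ => 0

/-- The vector of absorption rates `q = -Q 1`. -/
def exitRate {S : Type*} [Fintype S] (Q : Matrix S S ℝ) : S → ℝ := -(Q *ᵥ 1)

/-- Kronecker product of two vectors. -/
def kronVec {S S' : Type*} (v : S → ℝ) (w : S' → ℝ) : S × S' → ℝ := fun p => v p.1 * w p.2

/-- Kronecker sum `A ⊕ B = A ⊗ I + I ⊗ B` of two square matrices. -/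
def kronSum {S S' : Type*} [DecidableEq S] [DecidableEq S']
    (A : Matrix S S ℝ) (B : Matrix S' S' ℝ) : Matrix (S × S') (S × S') ℝ :=
  A ⊗ₖ (1 : Matrix S' S' ℝ) + (1 : Matrix S S ℝ) ⊗ₖ B

/-- Van Loan's function `V[A, B, C, u]`: the upper right block of
`exp (u • [[A, B], [0, C]])`. -/
def vanLoan {m n : Type*} [Fintype m] [DecidableEq m] [Fintype n] [DecidableEq n]
    (A : Matrix m m ℝ) (B : Matrix m n ℝ) (C : Matrix n n ℝ) (u : ℝ) : Matrix m n ℝ :=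
  (NormedSpace.exp (u • Matrix.fromBlocks A B 0 C)).toBlocks₁₂

/-- `P = ∑ k, u⁽ᵏ⁾ (eₖᵀ ⊗ eₖᵀ)`, where `u⁽ᵏ⁾ = U eₖ` is the `k`-th column of `U`. -/
def shockMatrix {E S : Type*} [Fintype S] [DecidableEq S] (U : Matrix E S ℝ) :
    Matrix E (S × S) ℝ :=
  ∑ k, Matrix.vecMulVec (U *ᵥ Pi.single k 1) (kronVec (Pi.single k 1) (Pi.single k 1))

/-! ### Markov jump processes and densities -/

/-- `X` is a time-homogeneous Markov jump process under `P` with right-continuous paths, values in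
the finite (discrete) state space `E`, initial distribution `π` and intensity matrix `G`:
for `0 = t₀ ≤ t₁ ≤ … ≤ tₙ`,
`P(X(t₀) = x₀, …, X(tₙ) = xₙ) = π(x₀) ∏ᵢ (exp ((tᵢ₊₁ - tᵢ) G))(xᵢ, xᵢ₊₁)`. -/
structure IsMarkovJumpProcess {Ω E : Type*} [MeasurableSpace Ω] [Fintype E] [DecidableEq E]
    (P : Measure Ω) (X : ℝ≥0 → Ω → E) (π : E → ℝ) (G : Matrix E E ℝ) : Prop where
  measurable : ∀ t x, MeasurableSet {ω | X t ω = x}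
  rightContinuous : ∀ ω t, ∀ᶠ s in 𝓝[>] t, X s ω = X t ω
  finiteDimensional : ∀ (n : ℕ) (t : Fin (n + 1) → ℝ≥0) (x : Fin (n + 1) → E),
    t 0 = 0 → Monotone t →
      P {ω | ∀ i, X (t i) ω = x i} = ENNReal.ofReal (π (x 0) *
        ∏ i : Fin n, NormedSpace.exp (((t i.succ : ℝ) - t i.castSucc) • G)
          (x i.castSucc) (x i.succ))

/-- The σ-algebra generated by a process with values in a discrete space. -/
abbrev processSigma {Ω E : Type*} (X : ℝ≥0 → Ω → E) : MeasurableSpace Ω :=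
  ⨆ t, MeasurableSpace.comap (X t) ⊤

/-- The random vector `X` has a density with respect to Lebesgue measure that equals `f` on the
nonnegative orthant and vanishes outside it. -/
def HasDensityOnNonneg {Ω F : Type*} [MeasurableSpace Ω] [MeasureSpace F] [Preorder F] [Zero F]
    (P : Measure Ω) (X : Ω → F) (f : F → ℝ) : Prop :=
  (∀ x, 0 ≤ x → 0 ≤ f x) ∧
    HasLaw X (volume.withDensity ((Set.Ici 0).indicator fun x => ENNReal.ofReal (f x))) P

/-! ### The common-shock construction

`E` is the set of pre-shock states and `S` the set of post-shock states. The joint process `J₁₂`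
lives on `E ⊕ S`; the processes `J₁`, `J₂` live on `E ⊕ S` together with a final state `none`. -/

/-- The shock time `τ₁₂ = inf {t ≥ 0 : J₁₂(t) ∉ E}` (equal to `0` if the set is empty). -/
def shockTime {Ω E S : Type*} (J₁₂ : ℝ≥0 → Ω → E ⊕ S) (ω : Ω) : ℝ≥0 :=
  sInf {t | ¬ ∃ e, J₁₂ t ω = Sum.inl e}

/-- The shock state `K = J₁₂(τ₁₂)`. -/
def shockState {Ω E S : Type*} (J₁₂ : ℝ≥0 → Ω → E ⊕ S) (ω : Ω) : E ⊕ S :=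
  J₁₂ (shockTime J₁₂ ω) ω

/-- The process `s ↦ J(τ₁₂ + s)` after the shock. -/
def postShock {Ω E S : Type*} (J₁₂ : ℝ≥0 → Ω → E ⊕ S) (J : ℝ≥0 → Ω → Option (E ⊕ S))
    (s : ℝ≥0) (ω : Ω) : Option (E ⊕ S) :=
  J (shockTime J₁₂ ω + s) ω

/-- The residual lifetime: the time that `J` spends in `S` after the shock, until it leaves `S`
(equal to `0` if it never does). -/
def residual {Ω E S : Type*} (J₁₂ : ℝ≥0 → Ω → E ⊕ S) (J : ℝ≥0 → Ω → Option (E ⊕ S))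
    (ω : Ω) : ℝ≥0 :=
  sInf {s | ¬ ∃ k, postShock J₁₂ J s ω = some (Sum.inr k)}

/-- The parameters: `α` is a probability vector on `E`, `T`, `Q₁`, `Q₂` are subintensity matrices
all of whose states are transient (that is, the matrices are nonsingular), `U` is a matrix of
nonnegative rates with `T 1 + U 1 = 0`, and `a₁, a₂ > 0`. -/
structure IsParameter {E S : Type*} [Fintype E] [DecidableEq E] [Fintype S] [DecidableEq S]
    (α : E → ℝ) (T : Matrix E E ℝ) (U : Matrix E S ℝ) (Q₁ Q₂ : Matrix S S ℝ)
    (a₁ a₂ : ℝ) : Prop where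
  α_nonneg : ∀ i, 0 ≤ α i
  α_sum : ∑ i, α i = 1
  T_sub : IsSubintensity T
  T_unit : IsUnit T
  U_nonneg : ∀ i k, 0 ≤ U i k
  T_add_U : T *ᵥ 1 + U *ᵥ 1 = 0
  Q₁_sub : IsSubintensity Q₁
  Q₁_unit : IsUnit Q₁
  Q₂_sub : IsSubintensity Q₂
  Q₂_unit : IsUnit Q₂
  a₁_pos : 0 < a₁
  a₂_pos : 0 < a₂

/-- `J₁₂`, `J₁`, `J₂` form a common-shock model with parameters `α, T, U, Q₁, Q₂`:
* `J₁₂` is a Markov jump process with initial distribution `(α, 0)` and intensity matrix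
  `[[T, U], [0, 0]]`;
* `J₁ = J₂ = J₁₂` up to and including the shock time;
* given that the shock leads to the state `k`, the pre-shock evolution `J₁₂` and the two
  processes after the shock evolve independently, and the process `Jᵢ` after the shock is a
  Markov jump process that starts from `k` and is governed by the subintensity matrix
  `[[T, U], [0, Qᵢ]]`. -/
structure IsCommonShockModel {Ω E S : Type*} [MeasurableSpace Ω]
    [Fintype E] [DecidableEq E] [Fintype S] [DecidableEq S]
    (P : Measure Ω) (α : E → ℝ) (T : Matrix E E ℝ) (U : Matrix E S ℝ) (Q₁ Q₂ : Matrix S S ℝ)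
    (J₁₂ : ℝ≥0 → Ω → E ⊕ S) (J₁ J₂ : ℝ≥0 → Ω → Option (E ⊕ S)) : Prop where
  joint : IsMarkovJumpProcess P J₁₂ (Sum.elim α 0) (Matrix.fromBlocks T U 0 0)
  coincide₁ : ∀ ω t, t ≤ shockTime J₁₂ ω → J₁ t ω = some (J₁₂ t ω)
  coincide₂ : ∀ ω t, t ≤ shockTime J₁₂ ω → J₂ t ω = some (J₁₂ t ω)
  indep : ∀ k : S, P {ω | shockState J₁₂ ω = Sum.inr k} ≠ 0 →
    iIndep ![processSigma J₁₂, processSigma (postShock J₁₂ J₁), processSigma (postShock J₁₂ J₂)]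
      P[|{ω | shockState J₁₂ ω = Sum.inr k}]
  post₁ : ∀ k : S, P {ω | shockState J₁₂ ω = Sum.inr k} ≠ 0 →
    IsMarkovJumpProcess P[|{ω | shockState J₁₂ ω = Sum.inr k}] (postShock J₁₂ J₁)
      (Pi.single (some (Sum.inr k)) 1) (withCemetery (Matrix.fromBlocks T U 0 Q₁))
  post₂ : ∀ k : S, P {ω | shockState J₁₂ ω = Sum.inr k} ≠ 0 →
    IsMarkovJumpProcess P[|{ω | shockState J₁₂ ω = Sum.inr k}] (postShock J₁₂ J₂)
      (Pi.single (some (Sum.inr k)) 1) (withCemetery (Matrix.fromBlocks T U 0 Q₂))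

/-! ### The densities -/

/-- `g(t, y₁, y₂) = α exp(T t) P ((exp(Q₁ y₁) q₁) ⊗ (exp(Q₂ y₂) q₂))`. -/
def trivariateDensity {E S : Type*} [Fintype E] [DecidableEq E] [Fintype S] [DecidableEq S]
    (α : E → ℝ) (T : Matrix E E ℝ) (U : Matrix E S ℝ) (Q₁ Q₂ : Matrix S S ℝ)
    (t y₁ y₂ : ℝ) : ℝ :=
  α ⬝ᵥ ((NormedSpace.exp (t • T) * shockMatrix U) *ᵥ
    kronVec (NormedSpace.exp (y₁ • Q₁) *ᵥ exitRate Q₁) (NormedSpace.exp (y₂ • Q₂) *ᵥ exitRate Q₂))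

/-- `f(z₁, z₂) = α V[T, P, (a₁ Q₁) ⊕ (a₂ Q₂), m] (q₁(z₁, z₂) ⊗ q₂(z₁, z₂))` with
`m = min (z₁ / a₁) (z₂ / a₂)` and `qᵢ(z₁, z₂) = exp (Qᵢ (zᵢ - aᵢ m)) qᵢ`. -/
def bivariateDensity {E S : Type*} [Fintype E] [DecidableEq E] [Fintype S] [DecidableEq S]
    (α : E → ℝ) (T : Matrix E E ℝ) (U : Matrix E S ℝ) (Q₁ Q₂ : Matrix S S ℝ) (a₁ a₂ : ℝ)
    (z₁ z₂ : ℝ) : ℝ :=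
  α ⬝ᵥ (vanLoan T (shockMatrix U) (kronSum (a₁ • Q₁) (a₂ • Q₂)) (min (z₁ / a₁) (z₂ / a₂)) *ᵥ
    kronVec
      (NormedSpace.exp ((z₁ - a₁ * min (z₁ / a₁) (z₂ / a₂)) • Q₁) *ᵥ exitRate Q₁)
      (NormedSpace.exp ((z₂ - a₂ * min (z₁ / a₁) (z₂ / a₂)) • Q₂) *ᵥ exitRate Q₂))

end

end CSPH

namespace CSPH

/-! ### Matrix exponentials -/

section MatrixExp

variable {n : Type*} [Fintype n] [DecidableEq n]

/-! Everything is conditioned on the shock state `K = k`. States of `S` are absorbing for `J₁₂`, so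
almost surely "the shock has occurred by time `t` and led to `k`" is the event `J₁₂ t = k`. Its
probability is the `k`-entry of `(α, 0) exp (t [[T, U], [0, 0]])`, namely `∫₀ᵗ α exp(T s) u⁽ᵏ⁾ ds`;
hence `τ₁₂` has the sub-density `α exp(T t) u⁽ᵏ⁾` on `K = k` (`map_shockTime_restrict`). After the
shock, `Jᵢ` started in `k` is almost surely still in `S` at time `y` exactly when it has not yet
left, which has probability `(exp(Qᵢ y) 1) k`; differentiating gives the density `(exp(Qᵢ y) qᵢ) k`
(`map_entranceTime_post`). Conditional independence multiplies the three factors, and the sum over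
`k` is what the matrix `P` encodes. This is the density `g`.

Since `(X₁, X₂)` is `τ₁₂ (a₁, a₂)` plus the two residuals, its density is `∫ g(s, z₁ - a₁ s, z₂ - a₂
s) ds`, where nonnegativity of the arguments confines `s` to `[0, min (z₁ / a₁) (z₂ / a₂)]`. The
exponential of a Kronecker sum is the Kronecker product of the exponentials, so this is the
convolution integral that Van Loan's block exponential evaluates.

Two tools recur. Formulas for exponentials come from uniqueness for `f' = f M`
(`eq_vecMul_exp_of_hasDerivAt`). Nonsingularity gives `exp(Q t) 1 → 0` (`tendsto_exp_mulVec_one`),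
so the shock and both exits almost surely occur; this matters because the infimum of an empty set of
times is `0`. -/

lemma hasDerivAt_exp_smul_apply (M : Matrix n n ℝ) (t : ℝ) (i j : n) :
    HasDerivAt (fun t : ℝ => NormedSpace.exp (t • M) i j)
      ((NormedSpace.exp (t • M) * M) i j) t := by
  -- A Banach algebra norm is installed only locally; the statement concerns single entries and is
  -- independent of the norm.
  let _ : NormedRing (Matrix n n ℝ) := Matrix.linftyOpNormedRing
  let _ : NormedAlgebra ℝ (Matrix n n ℝ) := Matrix.linftyOpNormedAlgebra
  have h : HasDerivAt (fun t : ℝ => NormedSpace.exp (t • M)) (NormedSpace.exp (t • M) * M) t :=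
    hasDerivAt_exp_smul_const (𝕂 := ℝ) M t
  let L : Matrix n n ℝ →ₗ[ℝ] ℝ := Matrix.entryLinearMap ℝ ℝ i j
  exact (LinearMap.toContinuousLinearMap L).hasFDerivAt.comp_hasDerivAt t h

lemma exp_smul_mul_comm (M : Matrix n n ℝ) (t : ℝ) :
    NormedSpace.exp (t • M) * M = M * NormedSpace.exp (t • M) := by
  let _ : NormedRing (Matrix n n ℝ) := Matrix.linftyOpNormedRing
  let _ : NormedAlgebra ℝ (Matrix n n ℝ) := Matrix.linftyOpNormedAlgebra
  exact (((Commute.refl M).smul_left t).exp_left).eq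

lemma exp_add_smul (M : Matrix n n ℝ) (s t : ℝ) :
    NormedSpace.exp ((s + t) • M) = NormedSpace.exp (s • M) * NormedSpace.exp (t • M) := by
  rw [add_smul]
  exact Matrix.exp_add_of_commute _ _ (((Commute.refl M).smul_left s).smul_right t)

lemma exp_zero_smul (M : Matrix n n ℝ) : NormedSpace.exp ((0 : ℝ) • M) = 1 := by
  rw [zero_smul, NormedSpace.exp_zero]

lemma continuous_exp_smul_apply (M : Matrix n n ℝ) (i j : n) :
    Continuous fun t : ℝ => NormedSpace.exp (t • M) i j :=
  continuous_iff_continuousAt.2 fun t => (hasDerivAt_exp_smul_apply M t i j).continuousAt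

@[fun_prop]
lemma continuous_exp_smul (M : Matrix n n ℝ) :
    Continuous fun t : ℝ => NormedSpace.exp (t • M) :=
  continuous_matrix fun i j => continuous_exp_smul_apply M i j

/-- The linear system `f' = f M` of differential equations is solved by `f t = f 0 exp (t M)`. -/
lemma eq_vecMul_exp_of_hasDerivAt {M : Matrix n n ℝ} {f : ℝ → n → ℝ}
    (hf : ∀ t j, HasDerivAt (fun t => f t j) ((f t ᵥ* M) j) t) (t : ℝ) :
    f t = f 0 ᵥ* NormedSpace.exp (t • M) := by
  have hE : ∀ (t : ℝ) (i j : n), HasDerivAt (fun t : ℝ => NormedSpace.exp ((-t) • M) i j)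
      (-(M * NormedSpace.exp ((-t) • M)) i j) t := by
    intro t i j
    have := (hasDerivAt_exp_smul_apply M (-t) i j).scomp t (hasDerivAt_neg t)
    refine this.congr_deriv ?_
    rw [exp_smul_mul_comm, neg_one_smul]
  -- `f t` multiplied by `exp (-t M)` is constant: the two terms of the product rule are `± f M exp
  -- (-t M)`.
  have hg : ∀ t j, HasDerivAt (fun t => (f t ᵥ* NormedSpace.exp ((-t) • M)) j) 0 t := by
    intro t j
    have h := HasDerivAt.fun_sum (u := Finset.univ) fun i _ => (hf t i).mul (hE t i j)
    refine h.congr_deriv ?_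
    have : (f t ᵥ* M ᵥ* NormedSpace.exp ((-t) • M)) j
        = (f t ᵥ* (M * NormedSpace.exp ((-t) • M))) j := by rw [Matrix.vecMul_vecMul]
    rw [Finset.sum_add_distrib]
    simp only [Matrix.vecMul, dotProduct] at this ⊢
    simp only [mul_neg, Finset.sum_neg_distrib, ← this, add_neg_cancel]
  have hc : f t ᵥ* NormedSpace.exp ((-t) • M) = f 0 := by
    funext j
    have := is_const_of_deriv_eq_zero (fun t => (hg t j).differentiableAt)
      (fun t => (hg t j).deriv) t 0
    rw [this, neg_zero, exp_zero_smul, Matrix.vecMul_one]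
  rw [← hc, Matrix.vecMul_vecMul, ← exp_add_smul, neg_add_cancel, exp_zero_smul, Matrix.vecMul_one]

lemma exp_apply_nonneg_of_nonneg {M : Matrix n n ℝ} (hM : ∀ i j, 0 ≤ M i j) (i j : n) :
    0 ≤ NormedSpace.exp M i j := by
  let _ : NormedRing (Matrix n n ℝ) := Matrix.linftyOpNormedRing
  let _ : NormedAlgebra ℝ (Matrix n n ℝ) := Matrix.linftyOpNormedAlgebra
  have hp : ∀ (k : ℕ) (i j : n), 0 ≤ (M ^ k) i j := by
    intro k
    induction k with
    | zero => intro i j; rw [pow_zero, Matrix.one_apply]; split_ifs <;> norm_num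
    | succ k ih =>
      intro i j
      rw [pow_succ, Matrix.mul_apply]
      exact Finset.sum_nonneg fun l _ => mul_nonneg (ih i l) (hM l j)
  have h := NormedSpace.exp_series_hasSum_exp' (𝕂 := ℝ) M
  let L : Matrix n n ℝ →ₗ[ℝ] ℝ := Matrix.entryLinearMap ℝ ℝ i j
  have h' := h.mapL (LinearMap.toContinuousLinearMap L)
  refine h'.nonneg fun k => ?_
  change 0 ≤ ((k.factorial : ℝ)⁻¹ • M ^ k) i j
  rw [Matrix.smul_apply, smul_eq_mul]
  exact mul_nonneg (by positivity) (hp k i j)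

/-- Adding `c I` with `c` large makes `M` entrywise nonnegative, and as `c I` commutes with `M` this
only multiplies the exponential by the positive scalar `exp (t c)`. -/
lemma exp_smul_apply_nonneg {M : Matrix n n ℝ} (hM : ∀ i j, i ≠ j → 0 ≤ M i j) {t : ℝ}
    (ht : 0 ≤ t) (i j : n) : 0 ≤ NormedSpace.exp (t • M) i j := by
  set c : ℝ := ∑ i, |M i i| with hc
  have hN : ∀ i j, 0 ≤ (t • (M + c • (1 : Matrix n n ℝ))) i j := by
    intro i j
    refine mul_nonneg ht ?_
    by_cases hij : i = j
    · subst hij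
      have h1 : |M i i| ≤ c :=
        Finset.single_le_sum (f := fun i => |M i i|) (fun i _ => abs_nonneg _) (Finset.mem_univ i)
      have h2 := neg_abs_le (M i i)
      simp only [Matrix.add_apply, Matrix.smul_apply, Matrix.one_apply_eq, smul_eq_mul, mul_one]
      linarith
    · simpa [Matrix.one_apply_ne hij] using hM i j hij
  have hsum : t • M = t • (M + c • (1 : Matrix n n ℝ)) + (-(t * c)) • (1 : Matrix n n ℝ) := by
    rw [smul_add, smul_smul, neg_smul, add_neg_cancel_right]
  have hexp : NormedSpace.exp ((-(t * c)) • (1 : Matrix n n ℝ))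
      = Matrix.diagonal fun _ => Real.exp (-(t * c)) := by
    rw [Matrix.smul_one_eq_diagonal, Matrix.exp_diagonal]
    congr 1
    funext i
    rw [Pi.coe_exp, Real.exp_eq_exp_ℝ]
  rw [hsum, Matrix.exp_add_of_commute _ _ ((Commute.one_right _).smul_right _), hexp,
    Matrix.mul_diagonal]
  exact mul_nonneg (exp_apply_nonneg_of_nonneg hN i j) (Real.exp_pos _).le

/-- `exp (t M) 1 = 1 - ∫₀ᵗ exp (s M) (-M 1) ds`. -/
lemma integral_exp_mulVec_exitRate (M : Matrix n n ℝ) (t : ℝ) (i : n) :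
    ∫ s in (0 : ℝ)..t, (NormedSpace.exp (s • M) *ᵥ exitRate M) i
      = 1 - (NormedSpace.exp (t • M) *ᵥ 1) i := by
  have hd : ∀ s : ℝ, HasDerivAt (fun s => -(NormedSpace.exp (s • M) *ᵥ 1) i)
      ((NormedSpace.exp (s • M) *ᵥ exitRate M) i) s := by
    intro s
    have h := (HasDerivAt.fun_sum (u := Finset.univ) fun j _ =>
      (hasDerivAt_exp_smul_apply M s i j).mul_const (1 : ℝ)).neg
    refine h.congr_deriv ?_
    have : (NormedSpace.exp (s • M) *ᵥ exitRate M) i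
        = -((NormedSpace.exp (s • M) * M) *ᵥ 1) i := by
      rw [exitRate, Matrix.mulVec_neg, ← Matrix.mulVec_mulVec]; rfl
    rw [this]
    simp [Matrix.mulVec, dotProduct]
  have hc : Continuous fun s : ℝ => (NormedSpace.exp (s • M) *ᵥ exitRate M) i := by
    unfold Matrix.mulVec dotProduct
    exact continuous_finsetSum _ fun j _ => (continuous_exp_smul_apply M i j).mul continuous_const
  rw [intervalIntegral.integral_eq_sub_of_hasDerivAt (fun s _ => hd s)
    (hc.intervalIntegrable _ _), exp_zero_smul, Matrix.one_mulVec]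
  simp only [Pi.one_apply]
  ring

lemma exitRate_nonneg {S : Type*} [Fintype S] {Q : Matrix S S ℝ} (hQ : IsSubintensity Q) (i : S) : 0 ≤ exitRate Q i :=
  neg_nonneg.2 (hQ.rowSum_nonpos i)

lemma exp_mulVec_exitRate_nonneg {Q : Matrix n n ℝ} (hQ : IsSubintensity Q) {t : ℝ} (ht : 0 ≤ t)
    (i : n) : 0 ≤ (NormedSpace.exp (t • Q) *ᵥ exitRate Q) i :=
  Finset.sum_nonneg fun j _ =>
    mul_nonneg (exp_smul_apply_nonneg hQ.offDiag_nonneg ht i j) (exitRate_nonneg hQ j)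

/-- All states of a nonsingular subintensity matrix are transient. -/
lemma tendsto_exp_mulVec_one {Q : Matrix n n ℝ} (hQ : IsSubintensity Q) (hu : IsUnit Q) (i : n) :
    Filter.Tendsto (fun t : ℝ => (NormedSpace.exp (t • Q) *ᵥ 1) i) Filter.atTop (𝓝 0) := by
  set F : ℝ → n → ℝ := fun t => NormedSpace.exp (t • Q) *ᵥ 1 with hF
  have hsg : ∀ s t : ℝ, F (s + t) = NormedSpace.exp (s • Q) *ᵥ F t := by
    intro s t
    rw [hF]
    simp only
    rw [exp_add_smul, Matrix.mulVec_mulVec]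
  have h0 : ∀ t, 0 ≤ t → ∀ i, 0 ≤ F t i := fun t ht i =>
    Finset.sum_nonneg fun j _ =>
      mul_nonneg (exp_smul_apply_nonneg hQ.offDiag_nonneg ht i j) zero_le_one
  -- `F t = exp (s Q) F (t - s)` with `F (t - s) ≤ 1` and `exp (s Q) ≥ 0` entrywise, so `F t ≤ exp
  -- (s Q) 1 = F s`.
  have hanti : ∀ i, AntitoneOn (fun t => F t i) (Set.Ici 0) := by
    intro i s hs t ht hst
    have hle : ∀ j, F (t - s) j ≤ 1 := by
      intro j
      have h := integral_exp_mulVec_exitRate Q (t - s) j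
      have h2 : 0 ≤ ∫ r in (0 : ℝ)..(t - s), (NormedSpace.exp (r • Q) *ᵥ exitRate Q) j :=
        intervalIntegral.integral_nonneg (sub_nonneg.2 hst)
          fun r hr => exp_mulVec_exitRate_nonneg hQ hr.1 j
      simp only [hF]
      linarith
    have h3 : F t = NormedSpace.exp (s • Q) *ᵥ F (t - s) := by
      rw [← hsg, add_sub_cancel]
    simp only
    rw [h3]
    exact Finset.sum_le_sum fun j _ => mul_le_mul_of_nonneg_left (hle j)
      (exp_smul_apply_nonneg hQ.offDiag_nonneg hs i j)
  have hlim : ∀ i, ∃ v, Filter.Tendsto (fun t => F t i) Filter.atTop (𝓝 v) := by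
    intro i
    have hA : Antitone fun t : ℝ => F (max t 0) i := fun s t hst =>
      hanti i (le_max_right s 0) (le_max_right t 0) (max_le_max_right 0 hst)
    have := tendsto_atTop_ciInf hA ⟨0, by rintro _ ⟨t, rfl⟩; exact h0 _ (le_max_right _ _) i⟩
    refine ⟨_, this.congr' ?_⟩
    filter_upwards [Filter.eventually_ge_atTop 0] with t ht
    rw [max_eq_left ht]
  choose v hv using hlim
  -- The limit `v` is invariant under the semigroup. Differentiating this at `s = 0` gives `Q v =
  -- 0`, which forces `v = 0` as `Q` is nonsingular.
  have hfix : ∀ s : ℝ, NormedSpace.exp (s • Q) *ᵥ v = v := by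
    intro s
    funext i
    have h1 : Filter.Tendsto (fun t => F (s + t) i) Filter.atTop (𝓝 (v i)) :=
      (hv i).comp (Filter.tendsto_atTop_add_const_left _ s Filter.tendsto_id)
    have h2 : Filter.Tendsto (fun t => F (s + t) i) Filter.atTop
        (𝓝 ((NormedSpace.exp (s • Q) *ᵥ v) i)) := by
      simp only [hsg]
      exact tendsto_finsetSum _ fun j _ => (hv j).const_mul _
    exact tendsto_nhds_unique h2 h1
  have hQv : Q *ᵥ v = 0 := by
    funext i
    have hd := HasDerivAt.fun_sum (u := Finset.univ) fun j _ =>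
      (hasDerivAt_exp_smul_apply Q 0 i j).mul_const (v j)
    have hd' : HasDerivAt (fun _ : ℝ => v i) ((Q *ᵥ v) i) 0 := by
      refine (hd.congr_deriv ?_).congr_of_eventuallyEq (Filter.Eventually.of_forall fun s => ?_)
      · rw [exp_zero_smul, one_mul]; rfl
      · exact (congrFun (hfix s) i).symm
    exact hd'.unique (hasDerivAt_const 0 (v i))
  have hv0 : v = 0 := by
    obtain ⟨R, hR⟩ := hu.exists_left_inv
    rw [← Matrix.one_mulVec v, ← hR, ← Matrix.mulVec_mulVec, hQv, Matrix.mulVec_zero]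
  simpa [hv0] using hv i

end MatrixExp

/-! ### Exponentials of block triangular matrices and of Kronecker sums -/

section BlockExp

variable {m n : Type*} [Fintype m] [DecidableEq m] [Fintype n] [DecidableEq n]

lemma continuous_vecMul_exp_vecMul_exp_neg (α : m → ℝ) (A : Matrix m m ℝ) (B : Matrix m n ℝ)
    (C : Matrix n n ℝ) : Continuous fun s : ℝ =>
      α ᵥ* NormedSpace.exp (s • A) ᵥ* B ᵥ* NormedSpace.exp ((-s) • C) :=
  ((continuous_const.matrix_vecMul (continuous_exp_smul A)).matrix_vecMul
    continuous_const).matrix_vecMul ((continuous_exp_smul C).comp continuous_neg)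

/-- The row vector `(α, 0) exp (t [[A, B], [0, C]])` in closed form. -/
lemma elim_vecMul_exp_fromBlocks (α : m → ℝ) (A : Matrix m m ℝ) (B : Matrix m n ℝ)
    (C : Matrix n n ℝ) (t : ℝ) :
    Sum.elim α 0 ᵥ* NormedSpace.exp (t • Matrix.fromBlocks A B 0 C)
      = Sum.elim (α ᵥ* NormedSpace.exp (t • A)) (fun j =>
          ∑ i, (∫ s in (0 : ℝ)..t, (α ᵥ* NormedSpace.exp (s • A) ᵥ* B
            ᵥ* NormedSpace.exp ((-s) • C)) i) * NormedSpace.exp (t • C) i j) := by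
  set w : ℝ → n → ℝ := fun s => α ᵥ* NormedSpace.exp (s • A) ᵥ* B ᵥ* NormedSpace.exp ((-s) • C)
    with hw
  set f : ℝ → m ⊕ n → ℝ := fun t => Sum.elim (α ᵥ* NormedSpace.exp (t • A)) (fun j =>
          ∑ i, (∫ s in (0 : ℝ)..t, w s i) * NormedSpace.exp (t • C) i j) with hf
  have hwc : ∀ i, Continuous fun s => w s i := fun i =>
    (continuous_apply i).comp (continuous_vecMul_exp_vecMul_exp_neg α A B C)
  have hder : ∀ t j, HasDerivAt (fun t => f t j) ((f t ᵥ* Matrix.fromBlocks A B 0 C) j) t := by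
    intro t j
    rw [Matrix.vecMul_fromBlocks]
    cases j with
    | inl j =>
      have h := HasDerivAt.fun_sum (u := Finset.univ) fun i _ =>
        (hasDerivAt_exp_smul_apply A t i j).const_mul (α i)
      refine h.congr_deriv ?_
      simp only [hf, Sum.elim_inl, Sum.elim_comp_inl, Matrix.vecMul_zero, add_zero,
        Matrix.vecMul_vecMul]
      rfl
    | inr j =>
      have h := HasDerivAt.fun_sum (u := Finset.univ) fun i _ =>
        ((hwc i).integral_hasStrictDerivAt 0 t).hasDerivAt.mul (hasDerivAt_exp_smul_apply C t i j)
      refine h.congr_deriv ?_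
      rw [Finset.sum_add_distrib]
      simp only [hf, Sum.elim_inr, Sum.elim_comp_inl, Sum.elim_comp_inr, Pi.add_apply]
      congr 1
      -- Differentiating the integral cancels `exp (-t C)` against `exp (t C)` and leaves the inflow
      -- `α exp (t A) B`; the other term reproduces the `C` part of the system.
      · change (w t ᵥ* NormedSpace.exp (t • C)) j = _
        rw [hw]
        simp only
        rw [Matrix.vecMul_vecMul _ _ (NormedSpace.exp (t • C)), ← exp_add_smul, neg_add_cancel,
          exp_zero_smul, Matrix.vecMul_one]
      · change ((fun i => ∫ s in (0 : ℝ)..t, w s i) ᵥ* (NormedSpace.exp (t • C) * C)) j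
          = (((fun i => ∫ s in (0 : ℝ)..t, w s i) ᵥ* NormedSpace.exp (t • C)) ᵥ* C) j
        rw [Matrix.vecMul_vecMul]
  have h0 : f 0 = Sum.elim α 0 := by
    funext j
    cases j <;> simp [hf, NormedSpace.exp_zero]
  rw [← h0, ← eq_vecMul_exp_of_hasDerivAt hder t]

/-- By the product rule, row `p` of the right side solves `f' = f (A ⊕ B)` with initial value the
unit vector at `p`. -/
lemma exp_smul_kronSum (A : Matrix m m ℝ) (B : Matrix n n ℝ) (t : ℝ) :
    NormedSpace.exp (t • kronSum A B) = NormedSpace.exp (t • A) ⊗ₖ NormedSpace.exp (t • B) := by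
  ext p q
  set f : ℝ → m × n → ℝ := fun t => (NormedSpace.exp (t • A) ⊗ₖ NormedSpace.exp (t • B)) p with hf
  have hder : ∀ t j, HasDerivAt (fun t => f t j) ((f t ᵥ* kronSum A B) j) t := by
    intro t j
    have h := (hasDerivAt_exp_smul_apply A t p.1 j.1).mul
      (hasDerivAt_exp_smul_apply B t p.2 j.2)
    refine h.congr_deriv ?_
    have : (NormedSpace.exp (t • A) ⊗ₖ NormedSpace.exp (t • B)) * kronSum A B
      = (NormedSpace.exp (t • A) * A) ⊗ₖ NormedSpace.exp (t • B)
        + NormedSpace.exp (t • A) ⊗ₖ (NormedSpace.exp (t • B) * B) := by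
      rw [kronSum, mul_add, ← Matrix.mul_kronecker_mul, ← Matrix.mul_kronecker_mul,
        mul_one, mul_one]
    exact (congrFun (congrFun this p) j).symm
  have h := congrFun (eq_vecMul_exp_of_hasDerivAt hder t) q
  have h0 : f 0 = Pi.single p 1 := by
    rw [hf]
    simp only [exp_zero_smul, Matrix.one_kronecker_one]
    funext q
    exact Matrix.one_eq_pi_single
  rw [h0, Matrix.single_one_vecMul] at h
  exact h.symm

lemma kronecker_mulVec_kronVec {S S' : Type*} [Fintype S] [Fintype S'] (A : Matrix S S ℝ)
    (B : Matrix S' S' ℝ) (v : S → ℝ) (w : S' → ℝ) :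
    (A ⊗ₖ B) *ᵥ kronVec v w = kronVec (A *ᵥ v) (B *ᵥ w) := by
  funext p
  simp only [Matrix.mulVec, dotProduct, kronVec, Matrix.kroneckerMap_apply,
    Fintype.sum_prod_type, Finset.sum_mul_sum]
  exact Finset.sum_congr rfl fun i _ => Finset.sum_congr rfl fun j _ => by ring

end BlockExp

/-! ### Entrance times of right-continuous processes -/

section EntranceTime

variable {Ω F : Type*}

/-- The first time at which `X` visits `B` (equal to `0` if it never does). -/
noncomputable def entranceTime (X : ℝ≥0 → Ω → F) (B : Set F) (ω : Ω) : ℝ≥0 :=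
  sInf {t | X t ω ∈ B}

variable {X : ℝ≥0 → Ω → F} {B : Set F} {ω : Ω}

/-- A right-continuous path in a discrete space keeps its state for a while, so it is seen in that
state at some time of a fixed countable dense set. This reduces path events to countably many times.
-/
lemma exists_denseSeq_eq (hrc : ∀ ω t, ∀ᶠ s in 𝓝[>] t, X s ω = X t ω) (ω : Ω) {t u : ℝ≥0}
    (htu : t < u) : ∃ n, t < TopologicalSpace.denseSeq ℝ≥0 n ∧ TopologicalSpace.denseSeq ℝ≥0 n < u ∧
      X (TopologicalSpace.denseSeq ℝ≥0 n) ω = X t ω := by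
  obtain ⟨v, hv, hvs⟩ := (mem_nhdsGT_iff_exists_Ioo_subset' htu).1 (hrc ω t)
  obtain ⟨_, ⟨n, rfl⟩, hn⟩ := (TopologicalSpace.denseRange_denseSeq ℝ≥0).exists_between
    (lt_min hv htu)
  exact ⟨n, hn.1, hn.2.trans_le (min_le_right _ _), hvs ⟨hn.1, hn.2.trans_le (min_le_left _ _)⟩⟩

lemma entranceTime_le_of_mem {t : ℝ≥0} (h : X t ω ∈ B) : entranceTime X B ω ≤ t :=
  csInf_le (OrderBot.bddBelow _) h

/-- The infimum is attained: a path outside `B` at that time would stay outside on an interval to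
its right, against the visits accumulating there. -/
lemma apply_entranceTime_mem (hrc : ∀ ω t, ∀ᶠ s in 𝓝[>] t, X s ω = X t ω)
    (h : ∃ t, X t ω ∈ B) : X (entranceTime X B ω) ω ∈ B := by
  by_contra hcon
  obtain ⟨u, hu, hus⟩ := (mem_nhdsGT_iff_exists_Ioo_subset' (lt_add_one _)).1
    (hrc ω (entranceTime X B ω))
  obtain ⟨s, hs, hsu⟩ := exists_lt_of_csInf_lt (s := {t | X t ω ∈ B}) h hu
  have hle : entranceTime X B ω ≤ s := entranceTime_le_of_mem hs
  rcases hle.eq_or_lt with heq | hlt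
  · exact hcon (heq ▸ hs)
  · have : X s ω = X (entranceTime X B ω) ω := hus ⟨hlt, hsu⟩
    exact hcon (this ▸ hs)

/-- A countable description, from which measurability follows. The last alternative is the path that
never visits `B`, whose entrance time is `0` by convention. -/
lemma entranceTime_le_iff (hrc : ∀ ω t, ∀ᶠ s in 𝓝[>] t, X s ω = X t ω) (t : ℝ≥0) :
    entranceTime X B ω ≤ t ↔ X t ω ∈ B ∨
      (∃ n, TopologicalSpace.denseSeq ℝ≥0 n ≤ t ∧ X (TopologicalSpace.denseSeq ℝ≥0 n) ω ∈ B) ∨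
      ∀ n, X (TopologicalSpace.denseSeq ℝ≥0 n) ω ∉ B := by
  constructor
  · intro h
    by_cases hne : ∃ s, X s ω ∈ B
    · have hmem := apply_entranceTime_mem hrc hne
      rcases h.eq_or_lt with heq | hlt
      · exact Or.inl (heq ▸ hmem)
      · obtain ⟨n, -, hn, hX⟩ := exists_denseSeq_eq hrc ω hlt
        exact Or.inr (Or.inl ⟨n, hn.le, hX ▸ hmem⟩)
    · exact Or.inr (Or.inr fun n hn => hne ⟨_, hn⟩)
  · rintro (h | ⟨n, hn, h⟩ | h)
    · exact entranceTime_le_of_mem h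
    · exact (entranceTime_le_of_mem h).trans hn
    · have hempty : {s | X s ω ∈ B} = ∅ := by
        ext s
        simp only [Set.mem_ofPred_eq, Set.mem_empty_iff_false, iff_false]
        intro hs
        obtain ⟨n, -, -, hX⟩ := exists_denseSeq_eq hrc ω (lt_add_one s)
        exact h n (hX ▸ hs)
      rw [entranceTime, hempty, NNReal.sInf_empty]
      exact zero_le

lemma measurable_entranceTime (m : MeasurableSpace Ω)
    (hrc : ∀ ω t, ∀ᶠ s in 𝓝[>] t, X s ω = X t ω)
    (hX : ∀ t, MeasurableSet[m] {ω | X t ω ∈ B}) : Measurable[m] (entranceTime X B) := by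
  refine measurable_of_Iic fun t => ?_
  have : entranceTime X B ⁻¹' Set.Iic t = {ω | X t ω ∈ B} ∪
      ((⋃ n, ⋃ _ : TopologicalSpace.denseSeq ℝ≥0 n ≤ t,
        {ω | X (TopologicalSpace.denseSeq ℝ≥0 n) ω ∈ B}) ∪
      ⋂ n, {ω | X (TopologicalSpace.denseSeq ℝ≥0 n) ω ∈ B}ᶜ) := by
    ext ω
    simp only [Set.mem_preimage, Set.mem_Iic, entranceTime_le_iff hrc t, Set.mem_union,
      Set.mem_ofPred_eq, Set.mem_iUnion, Set.mem_iInter, Set.mem_compl_iff, exists_prop]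
  rw [this]
  exact (hX t).union ((MeasurableSet.iUnion fun n => MeasurableSet.iUnion fun _ => hX _).union
    (MeasurableSet.iInter fun n => (hX _).compl))

variable [MeasurableSpace Ω] {P : Measure Ω}

/-- If `X` almost surely does not leave `B`, then it has entered `B` before time `t` if and only
if it is in `B` at time `t`. -/
lemma ae_entranceTime_le_iff (hrc : ∀ ω t, ∀ᶠ s in 𝓝[>] t, X s ω = X t ω)
    (hne : ∀ᵐ ω ∂P, ∃ t, X t ω ∈ B)
    (habs : ∀ s t, s ≤ t → P {ω | X s ω ∈ B ∧ X t ω ∉ B} = 0) (t : ℝ≥0) :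
    ∀ᵐ ω ∂P, entranceTime X B ω ≤ t ↔ X t ω ∈ B := by
  have h1 : ∀ᵐ ω ∂P, ∀ n, TopologicalSpace.denseSeq ℝ≥0 n ≤ t →
      ¬(X (TopologicalSpace.denseSeq ℝ≥0 n) ω ∈ B ∧ X t ω ∉ B) := by
    refine ae_all_iff.2 fun n => ?_
    by_cases hn : TopologicalSpace.denseSeq ℝ≥0 n ≤ t
    · filter_upwards [measure_eq_zero_iff_ae_notMem.1 (habs _ t hn)] with ω hω _ using hω
    · exact Filter.Eventually.of_forall fun ω h => absurd h hn
  filter_upwards [hne, h1] with ω hω h1ω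
  rw [entranceTime_le_iff hrc]
  refine ⟨?_, Or.inl⟩
  rintro (h | ⟨n, hn, h⟩ | h)
  · exact h
  · by_contra hc
    exact h1ω n hn ⟨h, hc⟩
  · obtain ⟨s, hs⟩ := hω
    obtain ⟨n, -, -, hX⟩ := exists_denseSeq_eq hrc ω (lt_add_one s)
    exact absurd (hX ▸ hs) (h n)

/-- If all states in `B` are almost surely absorbing, then `X` keeps the state in which it
enters `B`. -/
lemma ae_apply_eq_of_entranceTime_le [Countable F] (hrc : ∀ ω t, ∀ᶠ s in 𝓝[>] t, X s ω = X t ω)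
    (hne : ∀ᵐ ω ∂P, ∃ t, X t ω ∈ B)
    (habs : ∀ x ∈ B, ∀ s t, s ≤ t → P {ω | X s ω = x ∧ X t ω ≠ x} = 0) (t : ℝ≥0) :
    ∀ᵐ ω ∂P, entranceTime X B ω ≤ t → X t ω = X (entranceTime X B ω) ω := by
  have h1 : ∀ᵐ ω ∂P, ∀ n (x : F), TopologicalSpace.denseSeq ℝ≥0 n ≤ t → x ∈ B →
      ¬(X (TopologicalSpace.denseSeq ℝ≥0 n) ω = x ∧ X t ω ≠ x) := by
    refine ae_all_iff.2 fun n => ae_all_iff.2 fun x => ?_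
    by_cases hn : TopologicalSpace.denseSeq ℝ≥0 n ≤ t ∧ x ∈ B
    · filter_upwards [measure_eq_zero_iff_ae_notMem.1 (habs x hn.2 _ t hn.1)] with ω hω _ _ using hω
    · exact Filter.Eventually.of_forall fun ω h h' => absurd ⟨h, h'⟩ hn
  filter_upwards [hne, h1] with ω hω h1ω h
  rcases h.eq_or_lt with heq | hlt
  · rw [heq]
  · obtain ⟨n, -, hn, hX⟩ := exists_denseSeq_eq hrc ω hlt
    by_contra hc
    exact h1ω n _ hn.le (apply_entranceTime_mem hrc hω) ⟨hX, hc⟩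

lemma ae_exists_mem_of_tendsto
    (h : Filter.Tendsto (fun t : ℕ => P {ω | X t ω ∉ B}) Filter.atTop (𝓝 0)) :
    ∀ᵐ ω ∂P, ∃ t, X t ω ∈ B := by
  rw [ae_iff]
  refine le_antisymm (ge_of_tendsto' h fun t => measure_mono fun ω hω => ?_) (zero_le)
  exact fun hmem => hω ⟨_, hmem⟩

end EntranceTime

/-! ### Marginals of Markov jump processes -/

section Markov

variable {Ω F : Type*} [MeasurableSpace Ω] {P : Measure Ω} {X : ℝ≥0 → Ω → F}

/-- Restricting the measure to the measurable events `X t = x` avoids any measurability assumption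
on `p`. -/
lemma measure_eq_sum_measure_and [Fintype F] {p : Ω → Prop} (t : ℝ≥0)
    (hX : ∀ t x, MeasurableSet {ω | X t ω = x}) :
    P {ω | p ω} = ∑ x, P {ω | X t ω = x ∧ p ω} := by
  have h : P.restrict (⋃ x, {ω | X t ω = x}) = Measure.sum fun x => P.restrict {ω | X t ω = x} :=
    Measure.restrict_iUnion (fun x y hxy => Set.disjoint_left.2 fun ω hx hy =>
      hxy (hx.symm.trans hy)) (hX t)
  have hU : (⋃ x, {ω | X t ω = x}) = Set.univ := Set.eq_univ_of_forall fun ω => by simp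
  rw [hU, Measure.restrict_univ] at h
  conv_lhs => rw [h, Measure.sum_fintype, Measure.finsetSum_apply]
  refine Finset.sum_congr rfl fun x _ => ?_
  rw [Measure.restrict_apply' (hX t x)]
  congr 1
  ext ω
  exact and_comm

lemma measure_exists_eq {ι : Type*} [Fintype ι] {g : ι → F} (hg : Function.Injective g)
    (hX : ∀ t x, MeasurableSet {ω | X t ω = x}) (t : ℝ≥0) :
    P {ω | ∃ i, X t ω = g i} = ∑ i, P {ω | X t ω = g i} := by
  rw [Set.ofPred_exists, measure_iUnion (fun i j hij => Set.disjoint_left.2 fun ω hi hj =>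
    hij (hg (hi.symm.trans hj))) (fun i => hX t _), tsum_fintype]

variable [Fintype F] [DecidableEq F] {π : F → ℝ} {G : Matrix F F ℝ}

namespace IsMarkovJumpProcess

lemma measure_apply_eq (h : IsMarkovJumpProcess P X π G) (hπ : ∀ x, 0 ≤ π x)
    (hG : ∀ x y, x ≠ y → 0 ≤ G x y) (t : ℝ≥0) (x : F) :
    P {ω | X t ω = x} = ENNReal.ofReal ((π ᵥ* NormedSpace.exp ((t : ℝ) • G)) x) := by
  rw [measure_eq_sum_measure_and 0 h.measurable]
  have h1 : ∀ y, P {ω | X 0 ω = y ∧ X t ω = x}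
      = ENNReal.ofReal (π y * NormedSpace.exp ((t : ℝ) • G) y x) := by
    intro y
    have hfd := h.finiteDimensional 1 ![0, t] ![y, x] rfl
      (Fin.monotone_iff_le_succ.2 fun i => by fin_cases i; simp)
    simpa [Fin.forall_fin_two] using hfd
  simp only [h1]
  exact (ENNReal.ofReal_sum_of_nonneg fun y _ =>
    mul_nonneg (hπ y) (exp_smul_apply_nonneg hG t.2 y x)).symm

/-- Finite-dimensional laws are prescribed only for time grids starting at `0`, so the state at time
`0` is summed out; every summand contains the vanishing transition factor. -/
lemma measure_transition_eq_zero (h : IsMarkovJumpProcess P X π G) {s t : ℝ≥0} (hst : s ≤ t)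
    {x y : F} (hxy : NormedSpace.exp (((t : ℝ) - s) • G) x y = 0) :
    P {ω | X s ω = x ∧ X t ω = y} = 0 := by
  rw [measure_eq_sum_measure_and 0 h.measurable]
  refine Finset.sum_eq_zero fun z _ => ?_
  have hfd := h.finiteDimensional 2 ![0, s, t] ![z, x, y] rfl
    (Fin.monotone_iff_le_succ.2 fun i => by fin_cases i <;> simp [hst])
  simpa [Fin.forall_fin_succ, Fin.prod_univ_succ, hxy] using hfd

lemma measure_leave_eq_zero (h : IsMarkovJumpProcess P X π G) {s t : ℝ≥0} (hst : s ≤ t)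
    {A B : Set F} (hxy : ∀ x ∈ A, ∀ y ∈ B, NormedSpace.exp (((t : ℝ) - s) • G) x y = 0) :
    P {ω | X s ω ∈ A ∧ X t ω ∈ B} = 0 := by
  have hsub : {ω | X s ω ∈ A ∧ X t ω ∈ B}
      ⊆ ⋃ x ∈ A, ⋃ y ∈ B, {ω | X s ω = x ∧ X t ω = y} := by
    rintro ω ⟨h1, h2⟩
    simp only [Set.mem_iUnion]
    exact ⟨_, h1, _, h2, rfl, rfl⟩
  refine measure_mono_null hsub ?_
  refine (measure_biUnion_null_iff (Set.to_countable A)).2 fun x hx => ?_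
  refine (measure_biUnion_null_iff (Set.to_countable B)).2 fun y hy => ?_
  exact h.measure_transition_eq_zero hst (hxy x hx y hy)

lemma measurableSet_mem (h : IsMarkovJumpProcess P X π G) (B : Set F) (t : ℝ≥0) :
    MeasurableSet {ω | X t ω ∈ B} := by
  have : {ω | X t ω ∈ B} = ⋃ x ∈ B, {ω | X t ω = x} := by ext; simp
  rw [this]
  exact MeasurableSet.biUnion (Set.to_countable B) fun x _ => h.measurable t x

end IsMarkovJumpProcess

end Markov

/-! ### Densities on the half-line -/

lemma map_coe_eq_withDensity {Ω : Type*} [MeasurableSpace Ω] {μ : Measure Ω} [IsFiniteMeasure μ]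
    {Y : Ω → ℝ≥0} (hY : Measurable Y) {h : ℝ → ℝ} (hc : Continuous h) (h0 : ∀ x, 0 ≤ x → 0 ≤ h x)
    (hcdf : ∀ t : ℝ≥0, μ {ω | Y ω ≤ t} = ENNReal.ofReal (∫ s in (0 : ℝ)..t, h s)) :
    μ.map (fun ω => (Y ω : ℝ))
      = volume.withDensity ((Set.Ici 0).indicator fun x => ENNReal.ofReal (h x)) := by
  refine Measure.ext_of_Iic _ _ fun t => ?_
  rw [Measure.map_apply hY.coe_nnreal_real measurableSet_Iic,
    withDensity_apply _ measurableSet_Iic, setLIntegral_indicator measurableSet_Ici,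
    Set.Ici_inter_Iic]
  rcases lt_or_ge t 0 with ht | ht
  · rw [Set.Icc_eq_empty (not_le.2 ht), Measure.restrict_empty, lintegral_zero_measure]
    have : (fun ω => (Y ω : ℝ)) ⁻¹' Set.Iic t = ∅ := by
      ext ω
      simpa using ht.trans_le (Y ω).2
    rw [this, measure_empty]
  · lift t to ℝ≥0 using ht
    have : (fun ω => (Y ω : ℝ)) ⁻¹' Set.Iic (t : ℝ) = {ω | Y ω ≤ t} := by
      ext ω
      simp
    rw [this, hcdf, intervalIntegral.integral_of_le t.coe_nonneg, ← integral_Icc_eq_integral_Ioc,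
      ofReal_integral_eq_lintegral_ofReal]
    · exact hc.continuousOn.integrableOn_Icc
    · filter_upwards [ae_restrict_mem measurableSet_Icc] with x hx using h0 x hx.1

/-! ### The shock time and the shock state -/

/-- An absorbing state stays put: the constant unit vector at `i` solves `f' = f M` when row `i` of
`M` is zero. -/
lemma exp_smul_row_of_row_eq_zero {n : Type*} [Fintype n] [DecidableEq n] {M : Matrix n n ℝ}
    {i : n} (hi : ∀ j, M i j = 0) (t : ℝ) (j : n) :
    NormedSpace.exp (t • M) i j = (Pi.single i 1 : n → ℝ) j := by
  have h := eq_vecMul_exp_of_hasDerivAt (M := M) (f := fun _ => Pi.single i 1)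
    (fun t j => by
      rw [Matrix.single_one_vecMul, Matrix.row, hi j]
      exact hasDerivAt_const _ _) t
  rw [Matrix.single_one_vecMul] at h
  exact (congrFun h j).symm

section Shock

variable {E S : Type*} [Fintype E] [DecidableEq E] {α : E → ℝ} {T : Matrix E E ℝ}
  {U : Matrix E S ℝ}

/-- The density `α exp(T t) u⁽ᵏ⁾` of the shock time on the event that the shock leads to `k`. -/
noncomputable def shockDensity (α : E → ℝ) (T : Matrix E E ℝ) (U : Matrix E S ℝ) (k : S)
    (t : ℝ) : ℝ :=
  (α ᵥ* NormedSpace.exp (t • T) ᵥ* U) k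

lemma continuous_shockDensity (k : S) : Continuous (shockDensity α T U k) :=
  (continuous_apply k).comp ((continuous_const.matrix_vecMul
    (continuous_exp_smul T)).matrix_vecMul continuous_const)

lemma shockDensity_nonneg (hα : ∀ e, 0 ≤ α e) (hT : IsSubintensity T) (hU : ∀ e k, 0 ≤ U e k)
    (k : S) {t : ℝ} (ht : 0 ≤ t) : 0 ≤ shockDensity α T U k t :=
  Finset.sum_nonneg fun i _ => mul_nonneg (Finset.sum_nonneg fun j _ =>
    mul_nonneg (hα j) (exp_smul_apply_nonneg hT.offDiag_nonneg ht j i)) (hU i k)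

variable [Fintype S] [DecidableEq S]

lemma elim_vecMul_exp_shock (t : ℝ) :
    (Sum.elim α 0 : E ⊕ S → ℝ) ᵥ* NormedSpace.exp (t • Matrix.fromBlocks T U 0 (0 : Matrix S S ℝ))
      = Sum.elim (α ᵥ* NormedSpace.exp (t • T)) fun k =>
          ∫ s in (0 : ℝ)..t, shockDensity α T U k s := by
  rw [elim_vecMul_exp_fromBlocks]
  congr 1
  funext k
  simp only [smul_zero, NormedSpace.exp_zero, Matrix.vecMul_one]
  simp [Matrix.one_apply, shockDensity]

variable {Ω : Type*} [MeasurableSpace Ω] {P : Measure Ω}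
  {J : ℝ≥0 → Ω → E ⊕ S}

lemma measurable_shockTime
    (hJ : IsMarkovJumpProcess P J (Sum.elim α 0) (Matrix.fromBlocks T U 0 0)) :
    Measurable (shockTime J) :=
  measurable_entranceTime (B := {x | ¬∃ e, x = Sum.inl e}) _ hJ.rightContinuous
    (hJ.measurableSet_mem _)

lemma measure_shock_apply_eq (hα : ∀ e, 0 ≤ α e) (hT : IsSubintensity T) (hU : ∀ e k, 0 ≤ U e k)
    (hJ : IsMarkovJumpProcess P J (Sum.elim α 0) (Matrix.fromBlocks T U 0 0)) (t : ℝ≥0)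
    (x : E ⊕ S) : P {ω | J t ω = x} = ENNReal.ofReal ((Sum.elim (α ᵥ* NormedSpace.exp ((t : ℝ) • T))
      fun k => ∫ s in (0 : ℝ)..t, shockDensity α T U k s) x) := by
  rw [hJ.measure_apply_eq, elim_vecMul_exp_shock]
  · rintro (e | k)
    · exact hα e
    · exact le_rfl
  · rintro (e | k) (e' | k') h
    · exact hT.offDiag_nonneg _ _ fun h' => h (congrArg _ h')
    · exact hU _ _
    · exact le_rfl
    · exact le_rfl

/-- The probability of no shock by time `t` is `α exp(T t) 1`, which tends to `0` as `T` is
nonsingular. -/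
lemma ae_exists_shock (hα : ∀ e, 0 ≤ α e) (hT : IsSubintensity T) (hTu : IsUnit T)
    (hU : ∀ e k, 0 ≤ U e k)
    (hJ : IsMarkovJumpProcess P J (Sum.elim α 0) (Matrix.fromBlocks T U 0 0)) :
    ∀ᵐ ω ∂P, ∃ t, J t ω ∈ {x | ¬∃ e, x = Sum.inl e} := by
  refine ae_exists_mem_of_tendsto ?_
  have h1 : ∀ t : ℕ, P {ω | J t ω ∉ {x | ¬∃ e, x = Sum.inl e}}
      = ∑ e, ENNReal.ofReal ((α ᵥ* NormedSpace.exp ((t : ℝ) • T)) e) := by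
    intro t
    have : {ω | J t ω ∉ {x | ¬∃ e, x = Sum.inl e}} = {ω | ∃ e, J t ω = Sum.inl e} := by
      ext ω
      exact not_not
    rw [this, measure_exists_eq Sum.inl_injective hJ.measurable]
    refine Finset.sum_congr rfl fun e _ => ?_
    rw [measure_shock_apply_eq hα hT hU hJ]
    rfl
  have h2 : ∀ t : ℕ, ∑ e, ENNReal.ofReal ((α ᵥ* NormedSpace.exp ((t : ℝ) • T)) e)
      = ENNReal.ofReal (∑ i, α i * (NormedSpace.exp ((t : ℝ) • T) *ᵥ 1) i) := by
    intro t
    refine (ENNReal.ofReal_sum_of_nonneg fun e _ => Finset.sum_nonneg fun j _ => mul_nonneg (hα j)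
      (exp_smul_apply_nonneg hT.offDiag_nonneg t.cast_nonneg j e)).symm.trans ?_
    congr 1
    have := Matrix.dotProduct_mulVec α (NormedSpace.exp ((t : ℝ) • T)) 1
    rw [dotProduct_one] at this
    exact this.symm
  simp only [h1, h2]
  rw [← ENNReal.ofReal_zero]
  refine ENNReal.tendsto_ofReal ?_
  have h3 := tendsto_finsetSum Finset.univ fun i _ =>
    ((tendsto_exp_mulVec_one hT hTu i).comp tendsto_natCast_atTop_atTop).const_mul (α i)
  simpa using h3

/-- Almost surely, the shock has happened and led to `k` if and only if `J` is in `k`. -/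
lemma ae_shock_iff (hα : ∀ e, 0 ≤ α e) (hT : IsSubintensity T) (hTu : IsUnit T)
    (hU : ∀ e k, 0 ≤ U e k)
    (hJ : IsMarkovJumpProcess P J (Sum.elim α 0) (Matrix.fromBlocks T U 0 0)) (t : ℝ≥0) (k : S) :
    ∀ᵐ ω ∂P, (shockTime J ω ≤ t ∧ shockState J ω = Sum.inr k) ↔ J t ω = Sum.inr k := by
  have h := ae_apply_eq_of_entranceTime_le (B := {x | ¬∃ e, x = Sum.inl e}) hJ.rightContinuous
    (ae_exists_shock hα hT hTu hU hJ) (fun x hx s t hst => ?_) t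
  · filter_upwards [h] with ω hω
    constructor
    · rintro ⟨h1, h2⟩
      exact (hω h1).trans h2
    · intro h1
      have h2 : shockTime J ω ≤ t := entranceTime_le_of_mem (B := {x | ¬∃ e, x = Sum.inl e})
        fun ⟨e, he⟩ => Sum.inr_ne_inl (h1.symm.trans he)
      exact ⟨h2, (hω h2).symm.trans h1⟩
  · refine hJ.measure_leave_eq_zero hst (A := {x}) (B := {x}ᶜ) fun y hy z hz => ?_
    obtain rfl : y = x := hy
    rcases y with e | l
    · exact absurd ⟨e, rfl⟩ hx
    · rw [exp_smul_row_of_row_eq_zero (fun j => by cases j <;> rfl)]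
      exact Pi.single_eq_of_ne hz _

/-- Almost surely, `K = k` means that `J` is in `k` at some integer time, since the shock time is
finite and the state `k` is kept. -/
lemma nullMeasurableSet_shockState (hα : ∀ e, 0 ≤ α e) (hT : IsSubintensity T) (hTu : IsUnit T)
    (hU : ∀ e k, 0 ≤ U e k)
    (hJ : IsMarkovJumpProcess P J (Sum.elim α 0) (Matrix.fromBlocks T U 0 0)) (k : S) :
    NullMeasurableSet {ω | shockState J ω = Sum.inr k} P := by
  have hm : MeasurableSet (⋃ n : ℕ, {ω | J n ω = Sum.inr k}) :=
    MeasurableSet.iUnion fun n => hJ.measurable _ _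
  refine hm.nullMeasurableSet.congr ?_
  have h : ∀ᵐ ω ∂P, ∀ n : ℕ, (shockTime J ω ≤ n ∧ shockState J ω = Sum.inr k)
      ↔ J n ω = Sum.inr k := ae_all_iff.2 fun n => ae_shock_iff hα hT hTu hU hJ n k
  filter_upwards [h] with ω hω
  refine propext ⟨fun hx => ?_, fun hx => ?_⟩
  · obtain ⟨n, hn⟩ := Set.mem_iUnion.1 hx
    exact ((hω n).2 hn).2
  · obtain ⟨n, hn⟩ := exists_nat_ge (shockTime J ω)
    exact Set.mem_iUnion.2 ⟨n, (hω n).1 ⟨hn, hx⟩⟩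

lemma sum_restrict_shockState (hα : ∀ e, 0 ≤ α e) (hT : IsSubintensity T) (hTu : IsUnit T)
    (hU : ∀ e k, 0 ≤ U e k)
    (hJ : IsMarkovJumpProcess P J (Sum.elim α 0) (Matrix.fromBlocks T U 0 0)) :
    P = ∑ k, P.restrict {ω | shockState J ω = Sum.inr k} := by
  rw [← Measure.sum_fintype, ← Measure.restrict_iUnion_ae (fun k l hkl => Disjoint.aedisjoint
    (Set.disjoint_left.2 fun ω hk hl => hkl (Sum.inr_injective (hk.symm.trans hl))))
    (nullMeasurableSet_shockState hα hT hTu hU hJ)]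
  have h : (⋃ k, {ω | shockState J ω = Sum.inr k}) =ᵐ[P] Set.univ := by
    filter_upwards [ae_exists_shock hα hT hTu hU hJ] with ω hω
    refine propext ⟨fun _ => trivial, fun _ => ?_⟩
    have h1 : shockState J ω ∈ {x : E ⊕ S | ¬∃ e, x = Sum.inl e} :=
      apply_entranceTime_mem hJ.rightContinuous hω
    rcases hK : shockState J ω with e | k
    · exact absurd ⟨e, hK⟩ h1
    · exact Set.mem_iUnion.2 ⟨k, hK⟩
  rw [Measure.restrict_congr_set h, Measure.restrict_univ]

lemma map_shockTime_restrict [IsFiniteMeasure P] (hα : ∀ e, 0 ≤ α e) (hT : IsSubintensity T) (hTu : IsUnit T)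
    (hU : ∀ e k, 0 ≤ U e k)
    (hJ : IsMarkovJumpProcess P J (Sum.elim α 0) (Matrix.fromBlocks T U 0 0)) (k : S) :
    (P.restrict {ω | shockState J ω = Sum.inr k}).map (fun ω => (shockTime J ω : ℝ))
      = volume.withDensity
          ((Set.Ici 0).indicator fun t => ENNReal.ofReal (shockDensity α T U k t)) := by
  refine map_coe_eq_withDensity (measurable_shockTime hJ) (continuous_shockDensity k)
    (fun t ht => shockDensity_nonneg hα hT hU k ht) fun t => ?_
  rw [Measure.restrict_apply₀' (nullMeasurableSet_shockState hα hT hTu hU hJ k)]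
  have h : P ({ω | shockTime J ω ≤ t} ∩ {ω | shockState J ω = Sum.inr k})
      = P {ω | J t ω = Sum.inr k} := measure_congr <| by
    filter_upwards [ae_shock_iff hα hT hTu hU hJ t k] with ω hω using propext hω
  rw [h, measure_shock_apply_eq hα hT hU hJ]
  rfl

end Shock

/-! ### The residual lifetimes -/

section Residual

variable {E S : Type*} [Fintype E] [Fintype S]
  {T : Matrix E E ℝ} {U : Matrix E S ℝ} {Q : Matrix S S ℝ}

lemma withCemetery_offDiag_nonneg {Q : Matrix S S ℝ} (hQ : IsSubintensity Q) :
    ∀ x y, x ≠ y → 0 ≤ withCemetery Q x y := by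
  rintro (_ | i) (_ | j) h
  · exact le_rfl
  · exact le_rfl
  · exact neg_nonneg.2 (hQ.rowSum_nonpos i)
  · exact hQ.offDiag_nonneg i j fun h' => h (congrArg _ h')

lemma isSubintensity_fromBlocks (hT : IsSubintensity T) (hU : ∀ e k, 0 ≤ U e k)
    (hTU : T *ᵥ 1 + U *ᵥ 1 = 0) (hQ : IsSubintensity Q) :
    IsSubintensity (Matrix.fromBlocks T U 0 Q) where
  offDiag_nonneg := by
    rintro (e | k) (e' | k') h
    · exact hT.offDiag_nonneg _ _ fun h' => h (congrArg _ h')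
    · exact hU _ _
    · exact le_rfl
    · exact hQ.offDiag_nonneg _ _ fun h' => h (congrArg _ h')
  rowSum_nonpos := by
    rw [Matrix.fromBlocks_mulVec]
    rintro (e | k)
    · exact (congrFun hTU e).le
    · rw [Sum.elim_inr, Matrix.zero_mulVec, zero_add]
      exact hQ.rowSum_nonpos k

variable [DecidableEq E] [DecidableEq S]

lemma exp_withCemetery_none (M : Matrix S S ℝ) (t : ℝ) (i : S) :
    NormedSpace.exp (t • withCemetery M) none (some i) = 0 := by
  rw [exp_smul_row_of_row_eq_zero (fun j => rfl)]
  exact Pi.single_eq_of_ne (by simp) _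

/-- The candidate row puts the missing mass `1 - (exp (t M) 1) i` on the cemetery; the completed row
solves the system of `withCemetery M`. -/
lemma exp_withCemetery_some (M : Matrix S S ℝ) (t : ℝ) (i j : S) :
    NormedSpace.exp (t • withCemetery M) (some i) (some j) = NormedSpace.exp (t • M) i j := by
  set f : ℝ → Option S → ℝ := fun t x =>
    x.elim (1 - (NormedSpace.exp (t • M) *ᵥ 1) i) (NormedSpace.exp (t • M) i) with hf
  have hder : ∀ t x, HasDerivAt (fun t => f t x) ((f t ᵥ* withCemetery M) x) t := by
    rintro t (_ | j)
    · have h := (HasDerivAt.fun_sum (u := Finset.univ) fun j _ =>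
        (hasDerivAt_exp_smul_apply M t i j).mul_const (1 : ℝ)).const_sub 1
      refine h.congr_deriv ?_
      have h2 : -((NormedSpace.exp (t • M) * M) *ᵥ 1) i
          = ∑ j, NormedSpace.exp (t • M) i j * -(M *ᵥ 1) j := by
        rw [← Matrix.mulVec_mulVec]
        simp [Matrix.mulVec, dotProduct]
      refine Eq.trans h2 ?_
      simp [Matrix.vecMul, dotProduct, Fintype.sum_option, withCemetery, hf]
    · refine (hasDerivAt_exp_smul_apply M t i j).congr_deriv ?_
      simp [Matrix.vecMul, dotProduct, Fintype.sum_option, withCemetery, hf, Matrix.mul_apply]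
  have h := congrFun (eq_vecMul_exp_of_hasDerivAt hder t) (some j)
  have h0 : f 0 = Pi.single (some i) 1 := by
    funext x
    rcases x with _ | j
    · simp [hf, NormedSpace.exp_zero]
    · simp [hf, NormedSpace.exp_zero, Matrix.one_apply, Pi.single_apply, eq_comm]
  rw [h0, Matrix.single_one_vecMul] at h
  exact h.symm

/-- From `S` there is no return to `E`, so only `Q` governs these rows. -/
lemma exp_fromBlocks_inr (t : ℝ) (k : S) :
    NormedSpace.exp (t • Matrix.fromBlocks T U 0 Q) (Sum.inr k)
      = (Sum.elim 0 (NormedSpace.exp (t • Q) k) : E ⊕ S → ℝ) := by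
  set f : ℝ → E ⊕ S → ℝ := fun t => Sum.elim 0 (NormedSpace.exp (t • Q) k) with hf
  have hder : ∀ t x, HasDerivAt (fun t => f t x) ((f t ᵥ* Matrix.fromBlocks T U 0 Q) x) t := by
    rintro t (e | l)
    · refine (hasDerivAt_const t (0 : ℝ)).congr_deriv ?_
      simp [Matrix.vecMul_fromBlocks, hf]
    · refine (hasDerivAt_exp_smul_apply Q t k l).congr_deriv ?_
      rw [Matrix.vecMul_fromBlocks, Sum.elim_inr, hf]
      simp only [Sum.elim_comp_inl, Sum.elim_comp_inr, Matrix.zero_vecMul, zero_add]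
      rfl
  have h := eq_vecMul_exp_of_hasDerivAt hder t
  have h0 : f 0 = Pi.single (Sum.inr k) 1 := by
    funext x
    rcases x with e | l
    · simp [hf]
    · simp [hf, NormedSpace.exp_zero, Matrix.one_apply, Pi.single_apply, eq_comm]
  rw [h0, Matrix.single_one_vecMul] at h
  exact h.symm

variable {Ω : Type*} [MeasurableSpace Ω] {P : Measure Ω}
  {X : ℝ≥0 → Ω → Option (E ⊕ S)} {k : S}

lemma measure_post_apply_eq (hT : IsSubintensity T) (hU : ∀ e k, 0 ≤ U e k)
    (hTU : T *ᵥ 1 + U *ᵥ 1 = 0) (hQ : IsSubintensity Q)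
    (hX : IsMarkovJumpProcess P X (Pi.single (some (Sum.inr k)) 1)
      (withCemetery (Matrix.fromBlocks T U 0 Q))) (t : ℝ≥0) (x : E ⊕ S) :
    P {ω | X t ω = some x}
      = ENNReal.ofReal ((Sum.elim 0 (NormedSpace.exp ((t : ℝ) • Q) k) : E ⊕ S → ℝ) x) := by
  rw [hX.measure_apply_eq _
    (withCemetery_offDiag_nonneg (isSubintensity_fromBlocks hT hU hTU hQ)),
    Matrix.single_one_vecMul, Matrix.row, exp_withCemetery_some, exp_fromBlocks_inr]
  intro y
  rw [Pi.single_apply]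
  split_ifs <;> norm_num

/-- The time that the process after the shock spends in `S` is phase-type distributed. -/
lemma map_entranceTime_post [IsProbabilityMeasure P] (hT : IsSubintensity T) (hU : ∀ e k, 0 ≤ U e k)
    (hTU : T *ᵥ 1 + U *ᵥ 1 = 0) (hQ : IsSubintensity Q) (hQu : IsUnit Q)
    (hX : IsMarkovJumpProcess P X (Pi.single (some (Sum.inr k)) 1)
      (withCemetery (Matrix.fromBlocks T U 0 Q))) :
    P.map (fun ω => (entranceTime X {x | ¬∃ l, x = some (Sum.inr l)} ω : ℝ))
      = volume.withDensity ((Set.Ici 0).indicator fun y =>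
          ENNReal.ofReal ((NormedSpace.exp (y • Q) *ᵥ exitRate Q) k)) := by
  set B : Set (Option (E ⊕ S)) := {x | ¬∃ l, x = some (Sum.inr l)} with hB
  have hin : ∀ t : ℝ≥0, P {ω | X t ω ∉ B}
      = ENNReal.ofReal ((NormedSpace.exp ((t : ℝ) • Q) *ᵥ 1) k) := by
    intro t
    have h1 : {ω | X t ω ∉ B} = {ω | ∃ l, X t ω = some (Sum.inr l)} := by
      ext ω
      exact not_not
    rw [h1, measure_exists_eq (g := fun l => some (Sum.inr l))
      ((Option.some_injective _).comp Sum.inr_injective) hX.measurable]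
    simp only [measure_post_apply_eq hT hU hTU hQ hX, Sum.elim_inr]
    refine (ENNReal.ofReal_sum_of_nonneg fun l _ =>
      exp_smul_apply_nonneg hQ.offDiag_nonneg t.2 k l).symm.trans ?_
    congr 1
    exact (dotProduct_one _).symm
  have hne : ∀ᵐ ω ∂P, ∃ t, X t ω ∈ B := by
    refine ae_exists_mem_of_tendsto ?_
    simp only [hin]
    rw [← ENNReal.ofReal_zero]
    exact ENNReal.tendsto_ofReal
      ((tendsto_exp_mulVec_one hQ hQu k).comp tendsto_natCast_atTop_atTop)
  -- `B` consists of the cemetery and `E`. The cemetery is absorbing; states of `E` need not be, but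
  -- a process started in `k` visits them with probability `0` at each fixed time.
  have habs : ∀ s t, s ≤ t → P {ω | X s ω ∈ B ∧ X t ω ∉ B} = 0 := by
    intro s t hst
    have h1 : P {ω | X s ω ∈ ({none} : Set (Option (E ⊕ S))) ∧ X t ω ∈ Bᶜ} = 0 := by
      refine hX.measure_leave_eq_zero hst fun x hx y hy => ?_
      obtain rfl : x = none := hx
      obtain ⟨l, rfl⟩ := not_not.1 hy
      exact exp_withCemetery_none _ _ _
    have h2 : P (⋃ e : E, {ω | X s ω = some (Sum.inl e)}) = 0 := by
      refine measure_iUnion_null fun e => ?_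
      rw [measure_post_apply_eq hT hU hTU hQ hX]
      simp
    refine measure_mono_null (fun ω hω => ?_) (measure_union_null h1 h2)
    obtain ⟨hs, ht⟩ := hω
    rcases hx : X s ω with _ | e | l
    · exact Or.inl ⟨hx, ht⟩
    · exact Or.inr (Set.mem_iUnion.2 ⟨e, hx⟩)
    · exact absurd ⟨l, hx⟩ hs
  refine map_coe_eq_withDensity
    (measurable_entranceTime _ hX.rightContinuous (hX.measurableSet_mem _))
    ((continuous_apply k).comp ((continuous_exp_smul Q).matrix_mulVec continuous_const))
    (fun y hy => exp_mulVec_exitRate_nonneg hQ hy k) fun t => ?_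
  have h3 : P {ω | entranceTime X B ω ≤ t} = P {ω | X t ω ∉ B}ᶜ := measure_congr <| by
    filter_upwards [ae_entranceTime_le_iff hX.rightContinuous hne habs t] with ω hω
    exact propext (hω.trans not_not.symm)
  have h4 : MeasurableSet {ω | X t ω ∉ B} := hX.measurableSet_mem Bᶜ t
  rw [h3, prob_compl_eq_one_sub h4, hin, integral_exp_mulVec_exitRate,
    ENNReal.ofReal_sub, ENNReal.ofReal_one]
  exact Finset.sum_nonneg fun l _ =>
    mul_nonneg (exp_smul_apply_nonneg hQ.offDiag_nonneg t.2 k l) zero_le_one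

end Residual

/-! ### The densities in coordinates -/

section Density

variable {E S : Type*} [Fintype E] [DecidableEq E] [Fintype S] [DecidableEq S]
  {α : E → ℝ} {T : Matrix E E ℝ} {U : Matrix E S ℝ} {Q₁ Q₂ : Matrix S S ℝ} {a₁ a₂ : ℝ}

/-- Both components start from the same shock state, so only the diagonal of `S × S` carries mass in
`shockMatrix U`. -/
lemma vecMul_shockMatrix_dotProduct {E S : Type*} [Fintype E] [Fintype S] [DecidableEq S]
    {U : Matrix E S ℝ} (v : E → ℝ) (w₁ w₂ : S → ℝ) :
    (v ᵥ* shockMatrix U) ⬝ᵥ kronVec w₁ w₂ = ∑ k, (v ᵥ* U) k * w₁ k * w₂ k := by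
  rw [shockMatrix, Matrix.vecMul_sum, sum_dotProduct]
  refine Finset.sum_congr rfl fun k _ => ?_
  rw [Matrix.vecMul_vecMulVec, smul_dotProduct, Matrix.dotProduct_mulVec, dotProduct_single_one]
  have : kronVec (Pi.single k 1) (Pi.single k 1) ⬝ᵥ kronVec w₁ w₂ = w₁ k * w₂ k := by
    simp [dotProduct, kronVec, Fintype.sum_prod_type, Pi.single_apply]
  rw [this, smul_eq_mul, mul_assoc]

lemma trivariateDensity_eq_sum (t y₁ y₂ : ℝ) :
    trivariateDensity α T U Q₁ Q₂ t y₁ y₂ = ∑ k, shockDensity α T U k t *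
      (NormedSpace.exp (y₁ • Q₁) *ᵥ exitRate Q₁) k * (NormedSpace.exp (y₂ • Q₂) *ᵥ exitRate Q₂) k := by
  rw [trivariateDensity, Matrix.dotProduct_mulVec, ← Matrix.vecMul_vecMul,
    vecMul_shockMatrix_dotProduct]
  rfl

lemma continuous_exp_mulVec_exitRate (Q : Matrix S S ℝ) (k : S) :
    Continuous fun y : ℝ => (NormedSpace.exp (y • Q) *ᵥ exitRate Q) k :=
  (continuous_apply k).comp ((continuous_exp_smul Q).matrix_mulVec continuous_const)

lemma continuous_trivariateDensity :
    Continuous fun x : ℝ × ℝ × ℝ => trivariateDensity α T U Q₁ Q₂ x.1 x.2.1 x.2.2 := by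
  simp only [trivariateDensity_eq_sum]
  refine continuous_finsetSum _ fun k _ => Continuous.mul (Continuous.mul ?_ ?_) ?_
  · exact (continuous_shockDensity k).comp continuous_fst
  · exact (continuous_exp_mulVec_exitRate Q₁ k).comp (continuous_fst.comp continuous_snd)
  · exact (continuous_exp_mulVec_exitRate Q₂ k).comp (continuous_snd.comp continuous_snd)

lemma trivariateDensity_nonneg (hp : IsParameter α T U Q₁ Q₂ a₁ a₂) {t y₁ y₂ : ℝ} (ht : 0 ≤ t)
    (h₁ : 0 ≤ y₁) (h₂ : 0 ≤ y₂) : 0 ≤ trivariateDensity α T U Q₁ Q₂ t y₁ y₂ := by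
  rw [trivariateDensity_eq_sum]
  exact Finset.sum_nonneg fun k _ => mul_nonneg (mul_nonneg
    (shockDensity_nonneg hp.α_nonneg hp.T_sub hp.U_nonneg k ht)
    (exp_mulVec_exitRate_nonneg hp.Q₁_sub h₁ k)) (exp_mulVec_exitRate_nonneg hp.Q₂_sub h₂ k)

/-- Van Loan's formula. -/
lemma dotProduct_vanLoan_mulVec {m n : Type*} [Fintype m] [DecidableEq m] [Fintype n]
    [DecidableEq n] (α : m → ℝ) (A : Matrix m m ℝ) (B : Matrix m n ℝ) (C : Matrix n n ℝ) (u : ℝ)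
    (w : n → ℝ) : α ⬝ᵥ (vanLoan A B C u *ᵥ w) =
      ∫ s in (0 : ℝ)..u, (α ᵥ* NormedSpace.exp (s • A) ᵥ* B) ⬝ᵥ
        (NormedSpace.exp ((u - s) • C) *ᵥ w) := by
  have h1 : α ᵥ* vanLoan A B C u = fun j =>
      (Sum.elim α 0 ᵥ* NormedSpace.exp (u • Matrix.fromBlocks A B 0 C)) (Sum.inr j) := by
    funext j
    simp [Matrix.vecMul, dotProduct, vanLoan, Matrix.toBlocks₁₂]
  set W : n → ℝ := fun i => ∫ s in (0 : ℝ)..u, (α ᵥ* NormedSpace.exp (s • A) ᵥ* B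
    ᵥ* NormedSpace.exp ((-s) • C)) i with hW
  have h2 : α ᵥ* vanLoan A B C u = W ᵥ* NormedSpace.exp (u • C) := by
    rw [h1, elim_vecMul_exp_fromBlocks]
    rfl
  rw [Matrix.dotProduct_mulVec, h2, ← Matrix.dotProduct_mulVec, dotProduct]
  simp only [hW]
  simp only [← intervalIntegral.integral_mul_const]
  refine (intervalIntegral.integral_finsetSum fun i _ => Continuous.intervalIntegrable
    (((continuous_apply i).comp (continuous_vecMul_exp_vecMul_exp_neg α A B C)).mul
      continuous_const) _ _).symm.trans ?_
  refine intervalIntegral.integral_congr fun s _ => ?_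
  change (α ᵥ* NormedSpace.exp (s • A) ᵥ* B ᵥ* NormedSpace.exp ((-s) • C)) ⬝ᵥ
    (NormedSpace.exp (u • C) *ᵥ w) = _
  rw [← Matrix.dotProduct_mulVec, Matrix.mulVec_mulVec, ← exp_add_smul, neg_add_eq_sub]

/-- With `m` the minimum, `exp (aᵢ (m - s) Qᵢ) exp ((zᵢ - aᵢ m) Qᵢ) = exp ((zᵢ - aᵢ s) Qᵢ)`, so `m`
survives only as the upper limit of Van Loan's integral. -/
lemma bivariateDensity_eq_integral (z₁ z₂ : ℝ) :
    bivariateDensity α T U Q₁ Q₂ a₁ a₂ z₁ z₂ = ∫ s in (0 : ℝ)..(min (z₁ / a₁) (z₂ / a₂)),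
      trivariateDensity α T U Q₁ Q₂ s (z₁ - a₁ * s) (z₂ - a₂ * s) := by
  rw [bivariateDensity, dotProduct_vanLoan_mulVec]
  refine intervalIntegral.integral_congr fun s _ => ?_
  rw [exp_smul_kronSum, kronecker_mulVec_kronVec, Matrix.mulVec_mulVec, Matrix.mulVec_mulVec,
    smul_smul, smul_smul, ← exp_add_smul, ← exp_add_smul, trivariateDensity,
    Matrix.dotProduct_mulVec _ (NormedSpace.exp (s • T) * _), ← Matrix.vecMul_vecMul]
  congr 5 <;> ring_nf

lemma nonneg_sub_mul_of_le_min (h₁ : 0 < a₁) (h₂ : 0 < a₂) {z₁ z₂ s : ℝ} :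
    s ≤ min (z₁ / a₁) (z₂ / a₂) ↔ 0 ≤ z₁ - a₁ * s ∧ 0 ≤ z₂ - a₂ * s := by
  rw [le_min_iff, le_div_iff₀ h₁, le_div_iff₀ h₂, sub_nonneg, sub_nonneg, mul_comm s, mul_comm s]

lemma bivariateDensity_nonneg (hp : IsParameter α T U Q₁ Q₂ a₁ a₂) {z₁ z₂ : ℝ}
    (h₁ : 0 ≤ z₁) (h₂ : 0 ≤ z₂) : 0 ≤ bivariateDensity α T U Q₁ Q₂ a₁ a₂ z₁ z₂ := by
  rw [bivariateDensity_eq_integral]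
  refine intervalIntegral.integral_nonneg
    (le_min (div_nonneg h₁ hp.a₁_pos.le) (div_nonneg h₂ hp.a₂_pos.le)) fun s hs => ?_
  have h := (nonneg_sub_mul_of_le_min hp.a₁_pos hp.a₂_pos).1 hs.2
  exact trivariateDensity_nonneg hp hs.1 h.1 h.2

/-- Integrating out the shock time in the joint density of `(τ₁₂, X₁, X₂)`. -/
lemma lintegral_trivariateDensity (hp : IsParameter α T U Q₁ Q₂ a₁ a₂) (z : ℝ × ℝ) :
    ∫⁻ t, (Set.Ici 0).indicator (fun x : ℝ × ℝ × ℝ =>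
        ENNReal.ofReal (trivariateDensity α T U Q₁ Q₂ x.1 x.2.1 x.2.2)) (t, z - (a₁ * t, a₂ * t))
      = (Set.Ici 0).indicator (fun z : ℝ × ℝ =>
          ENNReal.ofReal (bivariateDensity α T U Q₁ Q₂ a₁ a₂ z.1 z.2)) z := by
  obtain ⟨z₁, z₂⟩ := z
  set b := min (z₁ / a₁) (z₂ / a₂) with hb
  set h : ℝ → ℝ := fun t => trivariateDensity α T U Q₁ Q₂ t (z₁ - a₁ * t) (z₂ - a₂ * t) with hh
  have hc : Continuous h :=
    continuous_trivariateDensity.comp (f := fun t : ℝ => (t, z₁ - a₁ * t, z₂ - a₂ * t))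
      (by fun_prop)
  have hind : ∀ t, (Set.Ici 0).indicator (fun x : ℝ × ℝ × ℝ =>
      ENNReal.ofReal (trivariateDensity α T U Q₁ Q₂ x.1 x.2.1 x.2.2))
        (t, (z₁, z₂) - (a₁ * t, a₂ * t))
      = (Set.Icc 0 b).indicator (fun t => ENNReal.ofReal (h t)) t := by
    intro t
    have hiff : ((t, (z₁, z₂) - (a₁ * t, a₂ * t)) : ℝ × ℝ × ℝ) ∈ Set.Ici (0 : ℝ × ℝ × ℝ)
        ↔ t ∈ Set.Icc 0 b := by
      rw [Set.mem_Icc, hb, nonneg_sub_mul_of_le_min hp.a₁_pos hp.a₂_pos]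
      exact Iff.rfl
    by_cases ht : t ∈ Set.Icc 0 b
    · rw [Set.indicator_of_mem ht, Set.indicator_of_mem (hiff.2 ht)]
      rfl
    · rw [Set.indicator_of_notMem ht, Set.indicator_of_notMem fun h' => ht (hiff.1 h')]
  simp only [hind]
  rw [lintegral_indicator measurableSet_Icc]
  by_cases hz : (z₁, z₂) ∈ Set.Ici (0 : ℝ × ℝ)
  · have hz' : 0 ≤ z₁ ∧ 0 ≤ z₂ := hz
    have hb0 : 0 ≤ b := le_min (div_nonneg hz'.1 hp.a₁_pos.le) (div_nonneg hz'.2 hp.a₂_pos.le)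
    rw [Set.indicator_of_mem hz, bivariateDensity_eq_integral,
      intervalIntegral.integral_of_le hb0, ← integral_Icc_eq_integral_Ioc,
      ofReal_integral_eq_lintegral_ofReal hc.continuousOn.integrableOn_Icc]
    filter_upwards [ae_restrict_mem measurableSet_Icc] with t ht
    have h' := (nonneg_sub_mul_of_le_min hp.a₁_pos hp.a₂_pos).1 ht.2
    exact trivariateDensity_nonneg hp ht.1 h'.1 h'.2
  · rw [Set.indicator_of_notMem hz]
    -- If some `zᵢ` is negative, so is `b`, and the range of integration is empty.
    have hb0 : b < 0 := by
      by_contra! hb0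
      have h' := (nonneg_sub_mul_of_le_min hp.a₁_pos hp.a₂_pos).1 hb0
      simp only [mul_zero, sub_zero] at h'
      exact hz h'
    rw [Set.Icc_eq_empty (not_le.2 hb0), Measure.restrict_empty, lintegral_zero_measure]

end Density

/-- The law of `c t + y` when `(t, y)` has the density `G`. -/
lemma map_add_withDensity {G : ℝ × ℝ × ℝ → ℝ≥0∞} (hG : Measurable G) {c : ℝ → ℝ × ℝ}
    (hc : Measurable c) :
    (volume.withDensity G).map (fun x => c x.1 + x.2)
      = volume.withDensity fun z => ∫⁻ t, G (t, z - c t) := by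
  have hφ : Measurable fun x : ℝ × ℝ × ℝ => c x.1 + x.2 :=
    (hc.comp measurable_fst).add measurable_snd
  have hG' : Measurable fun p : (ℝ × ℝ) × ℝ => G (p.2, p.1 - c p.2) :=
    hG.comp (measurable_snd.prodMk (measurable_fst.sub (hc.comp measurable_snd)))
  refine Measure.ext_of_lintegral _ fun f hf => ?_
  have hf' : Measurable fun x : ℝ × ℝ × ℝ => f (c x.1 + x.2) := hf.comp hφ
  rw [lintegral_map hf hφ, lintegral_withDensity_eq_lintegral_mul _ hG hf',
    lintegral_withDensity_eq_lintegral_mul _ hG'.lintegral_prod_right' hf, Measure.volume_eq_prod,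
    lintegral_prod _ (hG.mul hf').aemeasurable]
  -- For fixed `t`, translating by `c t` preserves Lebesgue measure; Tonelli then exchanges `t` and
  -- `z`.
  have hshift : ∀ t, ∫⁻ y : ℝ × ℝ, (G * fun x : ℝ × ℝ × ℝ => f (c x.1 + x.2)) (t, y)
      = ∫⁻ z : ℝ × ℝ, G (t, z - c t) * f z := by
    intro t
    rw [← lintegral_add_right_eq_self (fun z => G (t, z - c t) * f z) (c t)]
    refine lintegral_congr fun y => ?_
    rw [add_sub_cancel_right, Pi.mul_apply, add_comm y]
  simp only [hshift]
  rw [lintegral_lintegral_swap ((hG'.comp measurable_swap).mul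
    (hf.comp measurable_snd)).aemeasurable]
  refine lintegral_congr fun z => ?_
  rw [Pi.mul_apply, lintegral_mul_const]
  exact hG'.comp measurable_prodMk_left

/-! ### The common-shock model -/

section Model

variable {Ω E S : Type*} [MeasurableSpace Ω] [Fintype E] [DecidableEq E] [Fintype S]
  [DecidableEq S] {P : Measure Ω} [IsProbabilityMeasure P]
  {α : E → ℝ} {T : Matrix E E ℝ} {U : Matrix E S ℝ} {Q₁ Q₂ : Matrix S S ℝ} {a₁ a₂ : ℝ}
  {J₁₂ : ℝ≥0 → Ω → E ⊕ S} {J₁ J₂ : ℝ≥0 → Ω → Option (E ⊕ S)}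

lemma measurableSet_processSigma {Ω F : Type*} (X : ℝ≥0 → Ω → F) (t : ℝ≥0) (B : Set F) :
    MeasurableSet[processSigma X] {ω | X t ω ∈ B} :=
  le_iSup (fun t => MeasurableSpace.comap (X t) ⊤) t _ ⟨B, trivial, rfl⟩

lemma map_residual {k : S} {μ : Measure Ω} [IsProbabilityMeasure μ] {Q : Matrix S S ℝ}
    {J : ℝ≥0 → Ω → Option (E ⊕ S)} (hp : IsParameter α T U Q₁ Q₂ a₁ a₂)
    (hQ : IsSubintensity Q) (hQu : IsUnit Q)
    (hX : IsMarkovJumpProcess μ (postShock J₁₂ J) (Pi.single (some (Sum.inr k)) 1)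
      (withCemetery (Matrix.fromBlocks T U 0 Q))) :
    μ.map (fun ω => (residual J₁₂ J ω : ℝ)) = volume.withDensity ((Set.Ici 0).indicator fun y =>
      ENNReal.ofReal ((NormedSpace.exp (y • Q) *ᵥ exitRate Q) k)) :=
  map_entranceTime_post hp.T_sub hp.U_nonneg hp.T_add_U hQ hQu hX

lemma measurable_residual {Ω E S : Type*} {J₁₂ : ℝ≥0 → Ω → E ⊕ S} {J : ℝ≥0 → Ω → Option (E ⊕ S)} (m : MeasurableSpace Ω)
    (hrc : ∀ ω t, ∀ᶠ s in 𝓝[>] t, postShock J₁₂ J s ω = postShock J₁₂ J t ω)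
    (hm : ∀ t (B : Set (Option (E ⊕ S))), MeasurableSet[m] {ω | postShock J₁₂ J t ω ∈ B}) :
    Measurable[m] (residual J₁₂ J) :=
  measurable_entranceTime (B := {x | ¬∃ l, x = some (Sum.inr l)}) m hrc fun t => hm t _

/-- The law of `(τ₁₂, τ̃₁, τ̃₂)` on the event that the shock leads to `k`. -/
lemma map_times_restrict (hp : IsParameter α T U Q₁ Q₂ a₁ a₂)
    (hM : IsCommonShockModel P α T U Q₁ Q₂ J₁₂ J₁ J₂) (k : S) :
    (P.restrict {ω | shockState J₁₂ ω = Sum.inr k}).map (fun ω => ((shockTime J₁₂ ω : ℝ),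
        (residual J₁₂ J₁ ω : ℝ), (residual J₁₂ J₂ ω : ℝ)))
      = volume.withDensity ((Set.Ici 0).indicator fun x : ℝ × ℝ × ℝ =>
          ENNReal.ofReal (shockDensity α T U k x.1 *
            (NormedSpace.exp (x.2.1 • Q₁) *ᵥ exitRate Q₁) k *
            (NormedSpace.exp (x.2.2 • Q₂) *ᵥ exitRate Q₂) k)) := by
  set A := {ω | shockState J₁₂ ω = Sum.inr k} with hA
  have hτ := map_shockTime_restrict hp.α_nonneg hp.T_sub hp.T_unit hp.U_nonneg hM.joint k
  set d : ℝ → ℝ≥0∞ := (Set.Ici 0).indicator fun t => ENNReal.ofReal (shockDensity α T U k t)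
  set r₁ : ℝ → ℝ≥0∞ := (Set.Ici 0).indicator fun y =>
    ENNReal.ofReal ((NormedSpace.exp (y • Q₁) *ᵥ exitRate Q₁) k) with hr₁
  set r₂ : ℝ → ℝ≥0∞ := (Set.Ici 0).indicator fun y =>
    ENNReal.ofReal ((NormedSpace.exp (y • Q₂) *ᵥ exitRate Q₂) k) with hr₂
  have hd : Measurable d :=
    (continuous_shockDensity k).measurable.ennreal_ofReal.indicator measurableSet_Ici
  have hr₁m : Measurable r₁ :=
    (continuous_exp_mulVec_exitRate Q₁ k).measurable.ennreal_ofReal.indicator measurableSet_Ici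
  have hr₂m : Measurable r₂ :=
    (continuous_exp_mulVec_exitRate Q₂ k).measurable.ennreal_ofReal.indicator measurableSet_Ici
  have hprod : ((Set.Ici 0).indicator fun x : ℝ × ℝ × ℝ =>
      ENNReal.ofReal (shockDensity α T U k x.1 *
        (NormedSpace.exp (x.2.1 • Q₁) *ᵥ exitRate Q₁) k *
        (NormedSpace.exp (x.2.2 • Q₂) *ᵥ exitRate Q₂) k))
      = fun x => d x.1 * (r₁ x.2.1 * r₂ x.2.2) := by
    funext ⟨t, y₁, y₂⟩
    by_cases hx : 0 ≤ t ∧ 0 ≤ y₁ ∧ 0 ≤ y₂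
    · have hmem : ((t, y₁, y₂) : ℝ × ℝ × ℝ) ∈ Set.Ici (0 : ℝ × ℝ × ℝ) := hx
      have hs := shockDensity_nonneg hp.α_nonneg hp.T_sub hp.U_nonneg k hx.1
      rw [Set.indicator_of_mem hmem, ENNReal.ofReal_mul (mul_nonneg hs
        (exp_mulVec_exitRate_nonneg hp.Q₁_sub hx.2.1 k)), ENNReal.ofReal_mul hs, mul_assoc]
      simp only [d, r₁, r₂]
      rw [Set.indicator_of_mem (Set.mem_Ici.2 hx.1), Set.indicator_of_mem (Set.mem_Ici.2 hx.2.1),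
        Set.indicator_of_mem (Set.mem_Ici.2 hx.2.2)]
    · rw [Set.indicator_of_notMem (s := Set.Ici (0 : ℝ × ℝ × ℝ)) hx]
      simp only [d, r₁, r₂, Set.indicator_apply, Set.mem_Ici]
      split_ifs with h1 h2 h3 <;> simp
      exact absurd ⟨h1, h2, h3⟩ hx
  have hvol : (volume : Measure (ℝ × ℝ × ℝ)).withDensity (fun x => d x.1 * (r₁ x.2.1 * r₂ x.2.2))
      = (volume.withDensity d).prod ((volume.withDensity r₁).prod (volume.withDensity r₂)) := by
    rw [prod_withDensity hr₁m hr₂m, prod_withDensity hd]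
    · rfl
    · exact (hr₁m.comp measurable_fst).mul (hr₂m.comp measurable_snd)
  rw [hprod, hvol, ← hτ]
  -- The conditional hypotheses say nothing about a null shock state; there the restricted law of
  -- `τ₁₂` is zero, and both sides vanish.
  by_cases hk : P A = 0
  · have hr : P.restrict A = 0 := Measure.restrict_eq_zero.2 hk
    rw [hr, Measure.map_zero, Measure.map_zero, Measure.zero_prod]
  have := cond_isProbabilityMeasure hk
  have h₁ := hM.post₁ k hk
  have h₂ := hM.post₂ k hk
  rw [hr₁, hr₂, ← map_residual hp hp.Q₁_sub hp.Q₁_unit h₁, ← map_residual hp hp.Q₂_sub hp.Q₂_unit h₂]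
  have hmτ : Measurable fun ω => (shockTime J₁₂ ω : ℝ) :=
    (measurable_shockTime hM.joint).coe_nnreal_real
  have hm₁ : Measurable fun ω => (residual J₁₂ J₁ ω : ℝ) :=
    (measurable_residual _ h₁.rightContinuous fun t B => h₁.measurableSet_mem B t).coe_nnreal_real
  have hm₂ : Measurable fun ω => (residual J₁₂ J₂ ω : ℝ) :=
    (measurable_residual _ h₂.rightContinuous fun t B => h₂.measurableSet_mem B t).coe_nnreal_real
  -- Each of the three times is measurable for the σ-algebra of its own process, so independence of
  -- the processes passes to the times.
  have hind : iIndepFun ![fun ω => (shockTime J₁₂ ω : ℝ), fun ω => (residual J₁₂ J₁ ω : ℝ),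
      fun ω => (residual J₁₂ J₂ ω : ℝ)] P[|A] := by
    rw [iIndepFun_iff_iIndep]
    refine iIndep_of_iIndep_of_le (hM.indep k hk) fun i => ?_
    fin_cases i
    · exact Measurable.comap_le (measurable_entranceTime (B := {x | ¬∃ e, x = Sum.inl e})
        (processSigma J₁₂) hM.joint.rightContinuous
        fun t => measurableSet_processSigma _ t _).coe_nnreal_real
    · exact Measurable.comap_le (measurable_residual (processSigma (postShock J₁₂ J₁))
        h₁.rightContinuous fun t B => measurableSet_processSigma _ t B).coe_nnreal_real
    · exact Measurable.comap_le (measurable_residual (processSigma (postShock J₁₂ J₂))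
        h₂.rightContinuous fun t B => measurableSet_processSigma _ t B).coe_nnreal_real
  have hmeas : ∀ i, Measurable ((![fun ω => (shockTime J₁₂ ω : ℝ),
      fun ω => (residual J₁₂ J₁ ω : ℝ), fun ω => (residual J₁₂ J₂ ω : ℝ)] : Fin 3 → Ω → ℝ) i) := by
    intro i
    fin_cases i
    exacts [hmτ, hm₁, hm₂]
  have h12 := (indepFun_iff_map_prod_eq_prod_map_map hm₁.aemeasurable hm₂.aemeasurable).1
    (hind.indepFun (i := 1) (j := 2) (by decide))
  have h0 := (indepFun_iff_map_prod_eq_prod_map_map hmτ.aemeasurable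
    (hm₁.prodMk hm₂).aemeasurable).1 (hind.indepFun_prodMk hmeas 1 2 0 (by decide) (by decide)).symm
  -- The factor `P A` goes into the law of `τ₁₂`, whose density on `A` has total mass `P A`; the
  -- residual laws stay conditional probabilities.
  have hcond : P.restrict A = P A • P[|A] := by
    rw [ProbabilityTheory.cond, smul_smul, ENNReal.mul_inv_cancel hk (measure_ne_top _ _), one_smul]
  rw [hcond, Measure.map_smul, Measure.map_smul, h0, h12, Measure.prod_smul_left]

lemma hasLaw_times (hp : IsParameter α T U Q₁ Q₂ a₁ a₂)
    (hM : IsCommonShockModel P α T U Q₁ Q₂ J₁₂ J₁ J₂) :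
    HasLaw (fun ω => ((shockTime J₁₂ ω : ℝ), (residual J₁₂ J₁ ω : ℝ), (residual J₁₂ J₂ ω : ℝ)))
      (volume.withDensity ((Set.Ici 0).indicator fun x : ℝ × ℝ × ℝ =>
          ENNReal.ofReal (trivariateDensity α T U Q₁ Q₂ x.1 x.2.1 x.2.2))) P := by
  have hsum := sum_restrict_shockState hp.α_nonneg hp.T_sub hp.T_unit hp.U_nonneg hM.joint
  -- A shock state of positive probability is needed to know that the post-shock processes are
  -- measurable and right-continuous, hence that the residuals are measurable.
  obtain ⟨k, hk⟩ : ∃ k : S, P {ω | shockState J₁₂ ω = Sum.inr k} ≠ 0 := by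
    by_contra! hcon
    have h0 : P = 0 := by
      rw [hsum]
      exact Finset.sum_eq_zero fun k _ => Measure.restrict_eq_zero.2 (hcon k)
    exact IsProbabilityMeasure.ne_zero P h0
  have h₁ := hM.post₁ k hk
  have h₂ := hM.post₂ k hk
  have hm : Measurable fun ω => ((shockTime J₁₂ ω : ℝ), (residual J₁₂ J₁ ω : ℝ),
      (residual J₁₂ J₂ ω : ℝ)) :=
    (measurable_shockTime hM.joint).coe_nnreal_real.prodMk
      ((measurable_residual _ h₁.rightContinuous
        fun t B => h₁.measurableSet_mem B t).coe_nnreal_real.prodMk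
      (measurable_residual _ h₂.rightContinuous
        fun t B => h₂.measurableSet_mem B t).coe_nnreal_real)
  refine ⟨hm.aemeasurable, ?_⟩
  conv_lhs => rw [hsum]
  rw [← Measure.sum_fintype, Measure.map_sum hm.aemeasurable]
  simp only [map_times_restrict hp hM]
  rw [← withDensity_tsum, tsum_fintype]
  · congr 1
    funext x
    rw [Finset.sum_apply]
    by_cases hx : x ∈ Set.Ici (0 : ℝ × ℝ × ℝ)
    · have hx' : 0 ≤ x.1 ∧ 0 ≤ x.2.1 ∧ 0 ≤ x.2.2 := hx
      simp only [Set.indicator_of_mem hx, trivariateDensity_eq_sum]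
      rw [ENNReal.ofReal_sum_of_nonneg]
      exact fun k _ => mul_nonneg (mul_nonneg
        (shockDensity_nonneg hp.α_nonneg hp.T_sub hp.U_nonneg k hx'.1)
        (exp_mulVec_exitRate_nonneg hp.Q₁_sub hx'.2.1 k))
        (exp_mulVec_exitRate_nonneg hp.Q₂_sub hx'.2.2 k)
    · simp only [Set.indicator_of_notMem hx, Finset.sum_const_zero]
  · refine fun k => Measurable.indicator (Measurable.ennreal_ofReal ?_) measurableSet_Ici
    exact (((continuous_shockDensity k).measurable.comp measurable_fst).mul
      ((continuous_exp_mulVec_exitRate Q₁ k).measurable.comp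
        (measurable_fst.comp measurable_snd))).mul
      ((continuous_exp_mulVec_exitRate Q₂ k).measurable.comp (measurable_snd.comp measurable_snd))

lemma hasLaw_lifetimes (hp : IsParameter α T U Q₁ Q₂ a₁ a₂)
    (hM : IsCommonShockModel P α T U Q₁ Q₂ J₁₂ J₁ J₂) :
    HasLaw (fun ω => (a₁ * (shockTime J₁₂ ω : ℝ) + (residual J₁₂ J₁ ω : ℝ),
        a₂ * (shockTime J₁₂ ω : ℝ) + (residual J₁₂ J₂ ω : ℝ)))
      (volume.withDensity ((Set.Ici 0).indicator fun z : ℝ × ℝ =>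
          ENNReal.ofReal (bivariateDensity α T U Q₁ Q₂ a₁ a₂ z.1 z.2))) P := by
  have h := hasLaw_times hp hM
  have hc : Measurable fun t : ℝ => (a₁ * t, a₂ * t) := by fun_prop
  have hφ : Measurable fun x : ℝ × ℝ × ℝ => (a₁ * x.1, a₂ * x.1) + x.2 := by fun_prop
  have hG : Measurable ((Set.Ici 0).indicator fun x : ℝ × ℝ × ℝ =>
      ENNReal.ofReal (trivariateDensity α T U Q₁ Q₂ x.1 x.2.1 x.2.2)) :=
    continuous_trivariateDensity.measurable.ennreal_ofReal.indicator measurableSet_Ici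
  refine ⟨hφ.comp_aemeasurable h.aemeasurable, ?_⟩
  have h2 := map_add_withDensity hG hc
  rw [← h.map_eq, AEMeasurable.map_map_of_aemeasurable hφ.aemeasurable h.aemeasurable] at h2
  simp only [lintegral_trivariateDensity hp] at h2
  exact h2

end Model

end CSPH

theorem mainTheorem1 {Ω E S : Type*} [MeasurableSpace Ω]
    [Fintype E] [DecidableEq E] [Fintype S] [DecidableEq S]
    (P : Measure Ω) [IsProbabilityMeasure P]
    (α : E → ℝ) (T : Matrix E E ℝ) (U : Matrix E S ℝ) (Q₁ Q₂ : Matrix S S ℝ) (a₁ a₂ : ℝ)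
    (hparam : CSPH.IsParameter α T U Q₁ Q₂ a₁ a₂)
    (J₁₂ : ℝ≥0 → Ω → E ⊕ S) (J₁ J₂ : ℝ≥0 → Ω → Option (E ⊕ S))
    (hmodel : CSPH.IsCommonShockModel P α T U Q₁ Q₂ J₁₂ J₁ J₂) :
    CSPH.HasDensityOnNonneg P
      (fun ω => ((CSPH.shockTime J₁₂ ω : ℝ),
        (CSPH.residual J₁₂ J₁ ω : ℝ), (CSPH.residual J₁₂ J₂ ω : ℝ)))
      (fun x : ℝ × ℝ × ℝ => CSPH.trivariateDensity α T U Q₁ Q₂ x.1 x.2.1 x.2.2) ∧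
    CSPH.HasDensityOnNonneg P
      (fun ω => (a₁ * (CSPH.shockTime J₁₂ ω : ℝ) + (CSPH.residual J₁₂ J₁ ω : ℝ),
        a₂ * (CSPH.shockTime J₁₂ ω : ℝ) + (CSPH.residual J₁₂ J₂ ω : ℝ)))
      (fun z : ℝ × ℝ => CSPH.bivariateDensity α T U Q₁ Q₂ a₁ a₂ z.1 z.2) := by
  have h₁ := CSPH.hasLaw_times hparam hmodel
  have h₂ := CSPH.hasLaw_lifetimes hparam hmodel
  exact ⟨⟨fun x hx => CSPH.trivariateDensity_nonneg hparam hx.1 hx.2.1 hx.2.2, h₁⟩,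
    ⟨fun z hz => CSPH.bivariateDensity_nonneg hparam hz.1 hz.2, h₂⟩⟩
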